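/- Let $\mathcal M$ be the set of probability measures on $(\mathbb R,\mathcal B(\mathbb R))$, let $P_1\in\mathcal M$, and let $\mathcal P_0\subset\mathcal M$ be convex and closed in total variation with $\inf_{P\in\mathcal P_0}D_{\mathrm{KL}}(P_1,P)<\infty$. *Reverse information projection.* An e-variable for $\mathcal P_0$ is a measurable $B:\mathbb R\to[0,\infty]$ with $\mathbb E_P[B]\le 1$ for all $P\in\mathcal P_0$. Let $B^*$ be the numeraire, that is, the $P_1$-a.s. strictly positive e-variable with $\mathbb E_{P_1}[B/B^*]\le 1$ for every e-variable $B$. Let $P_0$ be a reverse information projection (RIPr) of $P_1$ on $\mathcal P_0$: a measure with total mass $k=P_0(\mathbb R)\le 1$ whose Radon–Nikodym derivative with respect to $P_1$ is $1/B^*$ (a part of $P_0$ singular to $P_1$ is allowed). Let $p_0,p_1$ be densities of $P_0,P_1$ with respect to a common $\sigma$-finite measure $\mu$, and let $p_1/p_0\in[0,\infty]$, where $0/0$ is read as $0$. Assume that $p_1/p_0$ is well defined (not $0/0$) $P$-a.s. for every $P\in\mathcal P_0$, in the sense that $P\ll P_0+P_1$ for all $P\in\mathcal P_0$. *Robust test.*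 For $\epsilon\in(0,1)$ let $c'=c'_\epsilon$ and $c''=c''_\epsilon$ be nonnegative real solutions of $$(1-\epsilon)\Big\{P_0\big[\tfrac{p_1}{p_0}<c''\big]+\tfrac1{c''}P_1\big[\tfrac{p_1}{p_0}\ge c''\big]\Big\}=k,\qquad (1-\epsilon)\Big\{P_1\big[\tfrac{p_1}{p_0}>c'\big]+c'P_0\big[\tfrac{p_1}{p_0}\le c'\big]\Big\}=1 .$$ Put $$\pi_\epsilon(x)=\max\Big\{c',\min\Big\{c'',\tfrac{p_1(x)}{p_0(x)}\Big\}\Big\},\qquad B_\epsilon(x)=\frac{\pi_\epsilon(x)}{\sup_{P\in\mathcal P_0}\mathbb E_P[\pi_\epsilon]+(c''-c')\epsilon},\qquad R_{n,\epsilon}=\prod_{i=1}^nB_\epsilon(X_i).$$ Let $H_1^\epsilon$ be either the contamination model $\{(1-\epsilon)P_1+\epsilon H:H\in\mathcal M\}$ or the total variation ball $\{Q\in\mathcal M:D_{\mathrm{TV}}(P_1,Q)\le\epsilon\}$. For a nonnegative process $M=(M_n)$ of functions of $X_1,X_2,\dots$ and a set $H\subset\mathcal M$, the growth rate of $M$ against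 $H$ is $\inf_{Q\in H}\lim_{n\to\infty}\frac1n\mathbb E_Q[\log M_n]$, where $X_1,X_2,\dots$ are i.i.d. with law $Q$ (with $\limsup$ if the limit does not exist). Then: 1. For every $\epsilon\in(0,1)$ and $Q\in H_1^\epsilon$ there is a real number $r^{Q,\epsilon}$ such that, for $X_1,X_2,\dots$ i.i.d. from $Q$, $\frac1n\mathbb E_Q[\log R_{n,\epsilon}]\to r^{Q,\epsilon}$ and $\frac1n\log R_{n,\epsilon}\to r^{Q,\epsilon}$ almost surely. 2. The growth rate $r^\epsilon=\inf_{Q\in H_1^\epsilon}r^{Q,\epsilon}$ of the robust RIPr test satisfies $r^\epsilon\to\inf_{P\in\mathcal P_0}D_{\mathrm{KL}}(P_1,P)$ as $\epsilon\downarrow0$. 3. This limit is the optimal growth rate for testing $\mathcal P_0$ against $P_1$: it is the maximum of the growth rates against $\{P_1\}$ of all test supermartingales for $\mathcal P_0$, that is, of all nonnegative processes $M$ with $M_0=1$ that are supermartingales, with respect to the filtration generated by the observations, whenever $X_1,X_2,\dots$ are i.i.d. from some $P\in\mathcal P_0$. -/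

import Mathlib

open MeasureTheory ProbabilityTheory Filter Set
open scoped ENNReal NNReal Topology

noncomputable section

namespace RobustRIPr

/-! ### Families of probability distributions on the real line -/

/-- Total variation distance `sup_A |P(A) - Q(A)|` over measurable sets `A`. -/
def tvDist (P Q : Measure ℝ) : ℝ :=
  ⨆ A : {A : Set ℝ // MeasurableSet A}, |P.real A.1 - Q.real A.1|

/-- A family of probability measures that is closed under mixtures of two members. -/
def IsConvexFamily (S : Set (ProbabilityMeasure ℝ)) : Prop :=
  Convex ℝ≥0 ((fun P : ProbabilityMeasure ℝ => (P : Measure ℝ)) '' S)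

/-- A family of probability measures that contains its limits in total variation. -/
def IsTVClosed (S : Set (ProbabilityMeasure ℝ)) : Prop :=
  ∀ (P : ℕ → ProbabilityMeasure ℝ) (Q : ProbabilityMeasure ℝ), (∀ n, P n ∈ S) →
    Tendsto (fun n => tvDist (P n) Q) atTop (𝓝 0) → Q ∈ S

/-- The contamination neighbourhood `{(1 - ε) P + ε H : H a probability measure}`. -/
def contaminationNbhd (P : ProbabilityMeasure ℝ) (ε : ℝ) : Set (ProbabilityMeasure ℝ) :=
  {Q | ∃ H : ProbabilityMeasure ℝ,
    (Q : Measure ℝ) =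
      ENNReal.ofReal (1 - ε) • (P : Measure ℝ) + ENNReal.ofReal ε • (H : Measure ℝ)}

/-- The total variation neighbourhood `{Q : D_TV(P, Q) ≤ ε}`. -/
def tvNbhd (P : ProbabilityMeasure ℝ) (ε : ℝ) : Set (ProbabilityMeasure ℝ) :=
  {Q | tvDist P Q ≤ ε}

/-! ### E-variables, the numeraire and the reverse information projection -/

/-- An e-variable for the null `S`: expectation at most one under every member. -/
def IsEVariable (S : Set (ProbabilityMeasure ℝ)) (B : ℝ → ℝ≥0∞) : Prop :=
  Measurable B ∧ ∀ P ∈ S, ∫⁻ x, B x ∂(P : Measure ℝ) ≤ 1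

/-- The numeraire: a `P₁`-almost surely positive e-variable `B` such that
`E_{P₁}[B' / B] ≤ 1` for every e-variable `B'`. -/
def IsNumeraire (S : Set (ProbabilityMeasure ℝ)) (P₁ : ProbabilityMeasure ℝ)
    (B : ℝ → ℝ≥0∞) : Prop :=
  IsEVariable S B ∧ (∀ᵐ x ∂(P₁ : Measure ℝ), 0 < B x) ∧
    ∀ B' : ℝ → ℝ≥0∞, IsEVariable S B' → ∫⁻ x, B' x / B x ∂(P₁ : Measure ℝ) ≤ 1

/-- `P₀` is a reverse information projection of `P₁` on `S`: a sub-probability measure whose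
Radon-Nikodym derivative with respect to `P₁` is `1 / B` for the numeraire `B`.
(This fixes the part of `P₀` that is absolutely continuous with respect to `P₁`; the measure
with density `1 / B` with respect to `P₁` is the smallest choice.) -/
def IsRIPr (S : Set (ProbabilityMeasure ℝ)) (P₁ : ProbabilityMeasure ℝ)
    (P₀ : Measure ℝ) : Prop :=
  P₀ univ ≤ 1 ∧ ∃ B : ℝ → ℝ≥0∞, IsNumeraire S P₁ B ∧
    P₀.rnDeriv (P₁ : Measure ℝ) =ᵐ[(P₁ : Measure ℝ)] fun x => (B x)⁻¹

/-! ### The robust test -/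

/-- The likelihood ratio `p₁ / p₀` with values in `[0, ∞]`. -/
def likelihoodRatio (p₀ p₁ : ℝ → ℝ≥0∞) (x : ℝ) : ℝ≥0∞ := p₁ x / p₀ x

/-- The equations for the truncation levels `c'` (here `lo`) and `c''` (here `hi`). They say
that Huber's least favourable densities `q₀` and `q₁` have total masses `P₀(ℝ)` and `1`. -/
structure IsHuberThresholds (P₀ P₁ : Measure ℝ) (L : ℝ → ℝ≥0∞) (ε lo hi : ℝ) : Prop where
  lo_nonneg : 0 ≤ lo
  hi_nonneg : 0 ≤ hi
  hi_eq : (1 - ε) * (P₀.real {x | L x < ENNReal.ofReal hi} +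
    hi⁻¹ * P₁.real {x | ENNReal.ofReal hi ≤ L x}) = P₀.real univ
  lo_eq : (1 - ε) * (P₁.real {x | ENNReal.ofReal lo < L x} +
    lo * P₀.real {x | L x ≤ ENNReal.ofReal lo}) = 1

/-- The ratio `q₁ / q₀ = max {c', min {c'', p₁ / p₀}}` of the least favourable densities. -/
def truncatedRatio (L : ℝ → ℝ≥0∞) (lo hi : ℝ) (x : ℝ) : ℝ :=
  max lo (min (ENNReal.ofReal hi) (L x)).toReal

/-- The robust bet: the truncated ratio divided by
`sup_{P ∈ S} E_P[q₁ / q₀] + (c'' - c') ε`. -/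
def robustBet (S : Set (ProbabilityMeasure ℝ)) (L : ℝ → ℝ≥0∞) (ε lo hi : ℝ) (x : ℝ) : ℝ :=
  truncatedRatio L lo hi x /
    ((⨆ P : S, ∫ y, truncatedRatio L lo hi y ∂(P.1 : Measure ℝ)) + (hi - lo) * ε)

/-- The robust test process `R n`, the product of the bets on the first `n` observations. -/
def robustProcess (S : Set (ProbabilityMeasure ℝ)) (L : ℝ → ℝ≥0∞) (ε lo hi : ℝ)
    (n : ℕ) (x : ℕ → ℝ) : ℝ :=
  ∏ i ∈ Finset.range n, robustBet S L ε lo hi (x i)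

/-! ### Growth rates -/

/-- The law of an i.i.d. sequence of observations from `Q`. -/
def iidLaw (Q : ProbabilityMeasure ℝ) : Measure (ℕ → ℝ) :=
  Measure.infinitePi fun _ : ℕ => (Q : Measure ℝ)

/-- The expectation `E[log M]` in `[-∞, ∞]` of a nonnegative variable `M`, with `log 0 = -∞`. -/
def meanLog {Ω : Type*} [MeasurableSpace Ω] (μ : Measure Ω) (M : Ω → ℝ) : EReal :=
  ((∫⁻ x, (ENNReal.log (ENNReal.ofReal (M x))).toENNReal ∂μ : ℝ≥0∞) : EReal) -
    ((∫⁻ x, (-ENNReal.log (ENNReal.ofReal (M x))).toENNReal ∂μ : ℝ≥0∞) : EReal)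

/-- The growth rate `lim_n E_Q[log M_n] / n` under i.i.d. observations from `Q`
(upper limit where the limit does not exist). -/
def growthRateAt (Q : ProbabilityMeasure ℝ) (M : ℕ → (ℕ → ℝ) → ℝ) : EReal :=
  limsup (fun n : ℕ => meanLog (iidLaw Q) (M n) / (n : EReal)) atTop

/-- The growth rate of `M` against the alternative `H`: the worst case over `H`. -/
def growthRate (H : Set (ProbabilityMeasure ℝ)) (M : ℕ → (ℕ → ℝ) → ℝ) : EReal :=
  ⨅ Q ∈ H, growthRateAt Q M

/-- The filtration of the observations: at time `n` the first `n` of them are known. -/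
def obsFiltration : Filtration ℕ (inferInstance : MeasurableSpace (ℕ → ℝ)) where
  seq n := ⨆ i : Fin n, MeasurableSpace.comap (fun x : ℕ → ℝ => x i) inferInstance
  mono' _ n h := iSup_le fun i =>
    le_iSup (fun j : Fin n => MeasurableSpace.comap (fun x : ℕ → ℝ => x j) inferInstance)
      (Fin.castLE h i)
  le' _ := iSup_le fun i => (measurable_pi_apply (i : ℕ)).comap_le

/-- A test supermartingale for i.i.d. observations from an unknown member of `S`. -/
def IsTestSupermartingale (S : Set (ProbabilityMeasure ℝ)) (M : ℕ → (ℕ → ℝ) → ℝ) : Prop :=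
  (∀ n x, 0 ≤ M n x) ∧ (∀ x, M 0 x = 1) ∧
    ∀ P ∈ S, Supermartingale M obsFiltration (iidLaw P)

end RobustRIPr

end

noncomputable section

namespace RobustRIPr

/-! ### Log-optimal densities in a convex family -/

/-! Write `L` for the likelihood ratio and `D` for the minimal divergence. Everything rests on
E_{P₁}[log L] = D.

One inequality is Jensen: `L` is an e-variable, so E_{P₁}[L / (dP₁/dP)] ≤ E_P[L] ≤ 1 for each null
`P` dominating `P₁`, whence E_{P₁}[log L] ≤ KL(P₁, P) when this is finite. For the other, take null
members whose divergences approach `D`. The concavity gap of the logarithm at a midpoint is `log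
cosh` of half the log difference, so the negative log densities along a fast minimising sequence are
Cauchy in L¹(P₁); their limit `u` has mean `D` (`exists_log_optimal`). Optimality under mixing makes
exp(u), cut off to {L ≠ 0}, an e-variable, and comparing it with the numeraire gives D ≤ E_{P₁}[log
L] (`IsNumeraireRatio.integral_log_eq`).

Optimality at `P₁`: the products of `L` grow at rate `D`, while changing measure from a null `P` on
the first `n` observations, with Jensen, bounds the rate of any test supermartingale by KL(P₁, P).

For the robust test, the logarithm of the bet is bounded, which yields both limits for fixed ε. As ε
tends to 0, Huber's equations, rewritten as identities for ∫ (L - hi)₊ dP₀ and ∫ (lo - L)₊ dP₀, show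
four things: ε·hi vanishes; ε times the range of the log truncated ratio vanishes, so moving within
the total variation ball costs nothing in the limit; the supremum over the null is at most 1 + o(1);
and truncation lowers E_{P₁}[log L] by at most o(1). This bounds the rate below. The upper bound
comes from evaluating at `P₁` and using that the truncated ratio divided by its supremum is itself
an e-variable. -/

lemma abs_le_add_mul_log_cosh {η : ℝ} (hη : 0 < η) (hη1 : η ≤ 1) (x : ℝ) :
    |x| ≤ η + 8 / η * Real.log (Real.cosh x) := by
  rw [← Real.cosh_abs]
  set y := |x| with hy
  have hy0 : 0 ≤ y := abs_nonneg x
  have hl : 0 ≤ Real.log (Real.cosh y) := Real.log_nonneg (Real.one_le_cosh y)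
  have hc : 1 + y ^ 2 / 4 ≤ Real.cosh y := by
    rw [Real.cosh_eq]
    have h1 := Real.quadratic_le_exp_of_nonneg hy0
    have h2 := Real.add_one_le_exp (-y)
    linarith
  have h8 : 8 ≤ 8 / η := by
    rw [le_div_iff₀ hη]
    linarith
  -- `log cosh` is quadratic near 0 and linear far out. A linear bound therefore costs an additive
  -- `η` near 0; for η < y ≤ 2 one uses log cosh y ≥ y²/8, and beyond 2 one uses log cosh y ≥ y -
  -- log 2.
  rcases le_or_gt y η with h | h
  · have : 0 ≤ 8 / η * Real.log (Real.cosh y) := by positivity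
    linarith
  rcases le_or_gt y 2 with h2 | h2
  · have h3 : 1 - (1 + y ^ 2 / 4)⁻¹ ≤ Real.log (Real.cosh y) :=
      (Real.one_sub_inv_le_log_of_pos (by positivity)).trans
        (Real.log_le_log (by positivity) hc)
    have h4 : y ^ 2 / 8 ≤ 1 - (1 + y ^ 2 / 4)⁻¹ := by
      have : 1 - (1 + y ^ 2 / 4)⁻¹ = y ^ 2 / (4 + y ^ 2) := by
        field_simp
        ring
      rw [this]
      gcongr
      nlinarith
    have h5 : y ≤ 8 / η * (y ^ 2 / 8) := by
      rw [show 8 / η * (y ^ 2 / 8) = y * (y / η) by field_simp]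
      exact le_mul_of_one_le_right hy0 ((one_le_div hη).2 h.le)
    have : 8 / η * (y ^ 2 / 8) ≤ 8 / η * Real.log (Real.cosh y) := by
      gcongr
      exact h4.trans h3
    linarith
  · have h3 : y - Real.log 2 ≤ Real.log (Real.cosh y) := by
      rw [← Real.log_exp y, ← Real.log_div (Real.exp_pos _).ne' two_ne_zero, Real.log_exp]
      refine Real.log_le_log (by positivity) ?_
      rw [Real.cosh_eq]
      have := Real.exp_pos (-y)
      linarith
    have h4 := Real.log_two_lt_d9
    have : 8 * Real.log (Real.cosh y) ≤ 8 / η * Real.log (Real.cosh y) := by gcongr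
    linarith

/-- The concavity gap of the logarithm at the midpoint is a function of the log ratio alone. The
weight is left as `1 - 1 / 2` to match the mixtures with general `t`. -/
lemma log_cosh_half_log_sub_log {a b : ℝ} (ha : 0 < a) (hb : 0 < b) :
    Real.log (Real.cosh ((Real.log a - Real.log b) / 2)) =
      Real.log ((1 - 1 / 2) * a + 1 / 2 * b) - (Real.log a + Real.log b) / 2 := by
  obtain ⟨p, rfl⟩ : ∃ p, a = Real.exp p := ⟨_, (Real.exp_log ha).symm⟩
  obtain ⟨q, rfl⟩ : ∃ q, b = Real.exp q := ⟨_, (Real.exp_log hb).symm⟩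
  simp only [Real.log_exp]
  rw [eq_sub_iff_add_eq, ← Real.log_exp ((p + q) / 2),
    ← Real.log_mul (Real.cosh_pos _).ne' (Real.exp_pos _).ne']
  congr 1
  rw [Real.cosh_eq, div_mul_eq_mul_div, add_mul, ← Real.exp_add, ← Real.exp_add]
  ring_nf

section LogOptimal

variable {Ω : Type*} [MeasurableSpace Ω]

lemma integrable_of_lintegral_ofReal_le_one {ν : Measure Ω} {f : Ω → ℝ} (hf : Measurable f)
    (h0 : ∀ x, 0 ≤ f x) (h1 : ∫⁻ x, ENNReal.ofReal (f x) ∂ν ≤ 1) : Integrable f ν :=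
  ⟨hf.aestronglyMeasurable, by
    rw [hasFiniteIntegral_iff_ofReal (ae_of_all _ h0)]
    exact h1.trans_lt ENNReal.one_lt_top⟩

/-- The logarithm of a mixture with a log-integrable density is integrable. -/
lemma integrable_log_mix {ν : Measure Ω} [IsFiniteMeasure ν] {f g : Ω → ℝ} {t : ℝ}
    (ht0 : 0 < t) (ht1 : t < 1)
    (hf : Measurable f) (hg : Measurable g) (hg0 : ∀ x, 0 ≤ g x)
    (hfi : Integrable f ν) (hgi : Integrable g ν)
    (hfpos : ∀ᵐ x ∂ν, 0 < f x) (hlog : Integrable (fun x => Real.log (f x)) ν) :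
    Integrable (fun x => Real.log ((1 - t) * f x + t * g x)) ν := by
  have hb : Integrable (fun x => |Real.log (1 - t)| + |Real.log (f x)| + f x + g x) ν :=
    (((integrable_const _).add hlog.abs).add hfi).add hgi
  refine hb.mono' (Measurable.aestronglyMeasurable (by fun_prop)) ?_
  filter_upwards [hfpos] with x hx
  have h1 : 0 < (1 - t) * f x := mul_pos (by linarith) hx
  have h2 : 0 ≤ t * g x := mul_nonneg ht0.le (hg0 x)
  have hlow : Real.log (1 - t) + Real.log (f x) ≤ Real.log ((1 - t) * f x + t * g x) := by
    rw [← Real.log_mul (by linarith) hx.ne']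
    exact Real.log_le_log h1 (by linarith)
  have hup := Real.log_le_sub_one_of_pos (x := (1 - t) * f x + t * g x) (by linarith)
  rw [Real.norm_eq_abs, abs_le]
  have := neg_abs_le (Real.log (1 - t))
  have := neg_abs_le (Real.log (f x))
  have := abs_nonneg (Real.log (1 - t))
  have := abs_nonneg (Real.log (f x))
  have := hg0 x
  constructor
  · linarith
  · nlinarith

/-- Two `η²`-minimisers are `O(η)`-close: the midpoint cannot beat `D`, so the mean concavity gap is
at most `η²`, and the `log cosh` bound turns this into 2η + (16/η)·η² = 18η. -/
lemma integral_abs_log_sub_log_le {ν : Measure Ω} [IsProbabilityMeasure ν] {f g : Ω → ℝ}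
    {D η : ℝ} (hη : 0 < η) (hη1 : η ≤ 1)
    (hf : Measurable f) (hg : Measurable g) (hg0 : ∀ x, 0 ≤ g x)
    (hfi : Integrable f ν) (hgi : Integrable g ν)
    (hfpos : ∀ᵐ x ∂ν, 0 < f x) (hgpos : ∀ᵐ x ∂ν, 0 < g x)
    (hflog : Integrable (fun x => Real.log (f x)) ν)
    (hglog : Integrable (fun x => Real.log (g x)) ν)
    (hfD : ∫ x, -Real.log (f x) ∂ν ≤ D + η ^ 2) (hgD : ∫ x, -Real.log (g x) ∂ν ≤ D + η ^ 2)
    (hD : D ≤ ∫ x, -Real.log ((1 - 1 / 2) * f x + 1 / 2 * g x) ∂ν) :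
    ∫ x, |Real.log (f x) - Real.log (g x)| ∂ν ≤ 18 * η := by
  have hmix := integrable_log_mix (t := 1 / 2) (by norm_num) (by norm_num)
    hf hg hg0 hfi hgi hfpos hflog
  have hsum : Integrable (fun x => (Real.log (f x) + Real.log (g x)) / 2) ν :=
    (hflog.add hglog).div_const 2
  have hdiff : Integrable (fun x => Real.log ((1 - 1 / 2) * f x + 1 / 2 * g x) -
        (Real.log (f x) + Real.log (g x)) / 2) ν := hmix.sub hsum
  have hdom : Integrable (fun x => 2 * η + 16 / η *
      (Real.log ((1 - 1 / 2) * f x + 1 / 2 * g x) -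
        (Real.log (f x) + Real.log (g x)) / 2)) ν :=
    (integrable_const _).add (hdiff.const_mul _)
  have hle : ∫ x, |Real.log (f x) - Real.log (g x)| ∂ν ≤ ∫ x, (2 * η + 16 / η *
      (Real.log ((1 - 1 / 2) * f x + 1 / 2 * g x) -
        (Real.log (f x) + Real.log (g x)) / 2)) ∂ν := by
    refine integral_mono_ae (hflog.sub hglog).abs hdom ?_
    filter_upwards [hfpos, hgpos] with x hx hy
    have h1 := abs_le_add_mul_log_cosh hη hη1 ((Real.log (f x) - Real.log (g x)) / 2)
    rw [log_cosh_half_log_sub_log hx hy, abs_div, abs_two] at h1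
    have h2 : 16 / η = 2 * (8 / η) := by ring
    simp only [h2]
    linarith
  refine hle.trans ?_
  rw [integral_add (integrable_const _) (hdiff.const_mul _), integral_const_mul (16 / η),
    integral_sub hmix hsum, integral_div,
    integral_add hflog hglog]
  rw [integral_neg] at hD hfD hgD
  simp only [integral_const, probReal_univ, smul_eq_mul, one_mul]
  have h3 : ∫ x, Real.log ((1 - 1 / 2) * f x + 1 / 2 * g x) ∂ν -
      (∫ x, Real.log (f x) ∂ν + ∫ x, Real.log (g x) ∂ν) / 2 ≤ η ^ 2 := by linarith
  have h4 : 16 / η * (∫ x, Real.log ((1 - 1 / 2) * f x + 1 / 2 * g x) ∂ν -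
      (∫ x, Real.log (f x) ∂ν + ∫ x, Real.log (g x) ∂ν) / 2) ≤ 16 / η * η ^ 2 := by gcongr
  have h5 : 16 / η * η ^ 2 = 16 * η := by field_simp
  linarith

/-- A sequence whose consecutive `L¹` distances decay geometrically has an `L¹` limit, along
which a subsequence converges almost everywhere. -/
lemma exists_limit_of_geometric {ν : Measure Ω} {F : ℕ → Ω → ℝ}
    (hF : ∀ n, Integrable (F n) ν) {C r : ℝ} (hr : r < 1)
    (h : ∀ n, ∫ x, |F n x - F (n + 1) x| ∂ν ≤ C * r ^ n) :
    ∃ (u : Ω → ℝ) (ns : ℕ → ℕ), Measurable u ∧ Integrable u ν ∧ StrictMono ns ∧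
      Tendsto (fun n => ∫ x, F n x ∂ν) atTop (𝓝 (∫ x, u x ∂ν)) ∧
      ∀ᵐ x ∂ν, Tendsto (fun n => F (ns n) x) atTop (𝓝 (u x)) := by
  let G : ℕ → Lp ℝ 1 ν := fun n => (hF n).toL1
  have hG : ∀ n, G n =ᵐ[ν] F n := fun n => (hF n).coeFn_toL1
  have hcau : CauchySeq G := by
    refine cauchySeq_of_le_geometric r C hr fun n => ?_
    rw [L1.dist_eq_integral_dist]
    refine le_trans (le_of_eq (integral_congr_ae ?_)) (h n)
    filter_upwards [hG n, hG (n + 1)] with x h1 h2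
    rw [h1, h2, Real.dist_eq]
  obtain ⟨g, hg⟩ := cauchySeq_tendsto_of_complete hcau
  obtain ⟨ns, hns, hae⟩ := (tendstoInMeasure_of_tendsto_Lp hg).exists_seq_tendsto_ae
  have hgm := (Lp.stronglyMeasurable g).measurable
  refine ⟨g, ns, hgm, L1.integrable_coeFn g, hns, ?_, ?_⟩
  · have := (continuous_integral (μ := ν) (G := ℝ)).tendsto g |>.comp hg
    refine this.congr fun n => integral_congr_ae (hG n)
  · have : ∀ᵐ x ∂ν, ∀ n, G n x = F n x := ae_all_iff.2 hG
    filter_upwards [hae, this] with x h1 h2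
    exact h1.congr fun n => h2 _

/-- The first-order condition at the endpoint `t = 0`. In the variable `s` the hypothesis bounds the
integral of log(1 + s·a) by log(1 + s) ≤ s; dividing by `s` and letting it tend to 0 recovers `a`.
Fatou suffices, so `a` need not be known integrable. -/
lemma lintegral_le_one_of_log_mix {ν : Measure Ω} {a : Ω → ℝ} (ha : Measurable a)
    (ha0 : ∀ x, 0 ≤ a x)
    (h : ∀ t ∈ Ioo (0 : ℝ) 1, ∫⁻ x, ENNReal.ofReal
      (Real.log (1 - t + t * a x) - Real.log (1 - t)) ∂ν ≤ ENNReal.ofReal (-Real.log (1 - t))) :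
    ∫⁻ x, ENNReal.ofReal (a x) ∂ν ≤ 1 := by
  -- substitute `t = s / (1 + s)`
  have hs : ∀ s : ℝ, 0 < s → ∫⁻ x, ENNReal.ofReal (Real.log (1 + s * a x) / s) ∂ν ≤ 1 := by
    intro s hs
    have hts : 1 - s / (1 + s) = (1 + s)⁻¹ := by field_simp; ring
    have ht := h (s / (1 + s)) ⟨by positivity, by rw [div_lt_one (by positivity)]; linarith⟩
    have heq : ∀ x, Real.log (1 - s / (1 + s) + s / (1 + s) * a x) - Real.log (1 - s / (1 + s)) =
        Real.log (1 + s * a x) := by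
      intro x
      have := ha0 x
      rw [hts, show (1 + s)⁻¹ + s / (1 + s) * a x = (1 + s)⁻¹ * (1 + s * a x) by field_simp,
        Real.log_mul (by positivity) (by positivity)]
      ring
    simp only [heq] at ht
    rw [hts, Real.log_inv, neg_neg] at ht
    have hdiv : ∀ x, ENNReal.ofReal (Real.log (1 + s * a x) / s) =
        ENNReal.ofReal s⁻¹ * ENNReal.ofReal (Real.log (1 + s * a x)) := by
      intro x
      rw [← ENNReal.ofReal_mul (by positivity)]
      congr 1
      ring
    simp only [hdiv]
    rw [lintegral_const_mul _ (by fun_prop)]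
    calc _ ≤ ENNReal.ofReal s⁻¹ * ENNReal.ofReal (Real.log (1 + s)) := by gcongr
      _ = ENNReal.ofReal (s⁻¹ * Real.log (1 + s)) := (ENNReal.ofReal_mul (by positivity)).symm
      _ ≤ 1 := by
        rw [ENNReal.ofReal_le_one, inv_mul_le_iff₀ hs]
        have := Real.log_le_sub_one_of_pos (x := 1 + s) (by positivity)
        linarith
  have hlim : ∀ x, Tendsto (fun n : ℕ => ENNReal.ofReal
      (Real.log (1 + (1 / ((n : ℝ) + 1)) * a x) / (1 / ((n : ℝ) + 1)))) atTop
      (𝓝 (ENNReal.ofReal (a x))) := by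
    intro x
    refine (ENNReal.continuous_ofReal.tendsto _).comp ?_
    have hder : HasDerivAt (fun s : ℝ => Real.log (1 + s * a x)) (a x) 0 := by
      have h1 : HasDerivAt (fun s : ℝ => 1 + s * a x) (a x) 0 := by
        simpa using ((hasDerivAt_id (0 : ℝ)).mul_const (a x)).const_add 1
      simpa using h1.log (by simp)
    have h2 := hder.tendsto_slope_zero_right
    have h3 : Tendsto (fun n : ℕ => 1 / ((n : ℝ) + 1)) atTop (𝓝[>] 0) :=
      tendsto_nhdsWithin_iff.2 ⟨tendsto_one_div_add_atTop_nhds_zero_nat,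
        Eventually.of_forall fun n => by simp only [mem_Ioi]; positivity⟩
    refine (h2.comp h3).congr fun n => ?_
    simp [div_eq_inv_mul]
  calc ∫⁻ x, ENNReal.ofReal (a x) ∂ν
      = ∫⁻ x, liminf (fun n : ℕ => ENNReal.ofReal
          (Real.log (1 + (1 / ((n : ℝ) + 1)) * a x) / (1 / ((n : ℝ) + 1)))) atTop ∂ν :=
        lintegral_congr fun x => (hlim x).liminf_eq.symm
    _ ≤ liminf (fun n : ℕ => ∫⁻ x, ENNReal.ofReal
          (Real.log (1 + (1 / ((n : ℝ) + 1)) * a x) / (1 / ((n : ℝ) + 1))) ∂ν) atTop :=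
        lintegral_liminf_le fun n => by fun_prop
    _ ≤ 1 := by
        refine liminf_le_of_le (by isBoundedDefault) fun b hb => ?_
        obtain ⟨n, hn⟩ := hb.exists
        exact hn.trans (hs _ (by positivity))

/-- The minimising densities themselves need not converge inside `C`; only their logarithms are
shown to converge in L¹. The optimality inequality is extracted along the sequence and passed to the
limit by Fatou, so no minimiser in `C` is required. Mixtures are asked for only almost everywhere
because Radon-Nikodym derivatives are only so determined. -/
theorem exists_log_optimal {ν : Measure Ω} [IsProbabilityMeasure ν] {C : Set (Ω → ℝ)} {D : ℝ}
    (hmeas : ∀ f ∈ C, Measurable f) (hnn : ∀ f ∈ C, ∀ x, 0 ≤ f x)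
    (hone : ∀ f ∈ C, ∫⁻ x, ENNReal.ofReal (f x) ∂ν ≤ 1)
    (hmix : ∀ f ∈ C, ∀ g ∈ C, ∀ t ∈ Ioo (0 : ℝ) 1,
      ∃ h ∈ C, h =ᵐ[ν] fun x => (1 - t) * f x + t * g x)
    (hD : ∀ f ∈ C, (∀ᵐ x ∂ν, 0 < f x) → Integrable (fun x => Real.log (f x)) ν →
      D ≤ ∫ x, -Real.log (f x) ∂ν)
    (happrox : ∀ δ : ℝ, 0 < δ → ∃ f ∈ C, (∀ᵐ x ∂ν, 0 < f x) ∧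
      Integrable (fun x => Real.log (f x)) ν ∧ ∫ x, -Real.log (f x) ∂ν ≤ D + δ) :
    ∃ u : Ω → ℝ, Measurable u ∧ Integrable u ν ∧ ∫ x, u x ∂ν = D ∧
      ∀ f ∈ C, ∫⁻ x, ENNReal.ofReal (f x * Real.exp (u x)) ∂ν ≤ 1 := by
  have hint : ∀ f ∈ C, Integrable f ν := fun f hf =>
    integrable_of_lintegral_ofReal_le_one (hmeas f hf) (hnn f hf) (hone f hf)
  have hmixD : ∀ f ∈ C, (∀ᵐ x ∂ν, 0 < f x) → Integrable (fun x => Real.log (f x)) ν →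
      ∀ g ∈ C, ∀ t ∈ Ioo (0 : ℝ) 1, D ≤ ∫ x, -Real.log ((1 - t) * f x + t * g x) ∂ν := by
    intro f hf hpos hlog g hg t ht
    obtain ⟨h, hh, he⟩ := hmix f hf g hg t ht
    have hl : (fun x => Real.log (h x)) =ᵐ[ν] fun x => Real.log ((1 - t) * f x + t * g x) := by
      filter_upwards [he] with x hx
      rw [hx]
    have hli := integrable_log_mix ht.1 ht.2 (hmeas f hf) (hmeas g hg) (hnn g hg) (hint f hf)
      (hint g hg) hpos hlog
    refine (hD h hh ?_ (hli.congr hl.symm)).trans (le_of_eq (integral_congr_ae ?_))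
    · filter_upwards [he, hpos] with x hx hp
      rw [hx]
      exact add_pos_of_pos_of_nonneg (mul_pos (by linarith [ht.2]) hp)
        (mul_nonneg ht.1.le (hnn g hg x))
    · filter_upwards [hl] with x hx
      rw [hx]
  -- Tolerance `η²` with η = 2⁻ⁿ makes consecutive L¹ distances at most 18·2⁻ⁿ, hence summable.
  have happrox' : ∀ n : ℕ, ∃ f ∈ C, (∀ᵐ x ∂ν, 0 < f x) ∧
      Integrable (fun x => Real.log (f x)) ν ∧
      ∫ x, -Real.log (f x) ∂ν ≤ D + ((1 / 2 : ℝ) ^ n) ^ 2 :=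
    fun n => happrox _ (by positivity)
  choose f hfC hfpos hflog hfD using happrox'
  obtain ⟨u, ns, hum, hui, hns, hlim, hae⟩ := exists_limit_of_geometric
    (F := fun n x => -Real.log (f n x)) (fun n => (hflog n).neg) (C := 18) (r := 1 / 2)
    (by norm_num) (fun n => by
      have := integral_abs_log_sub_log_le (ν := ν) (D := D) (η := (1 / 2 : ℝ) ^ n) (by positivity)
        (pow_le_one₀ (a := (1 / 2 : ℝ)) (by norm_num) (by norm_num)) (hmeas _ (hfC n)) (hmeas _ (hfC (n + 1)))
        (hnn _ (hfC _)) (hint _ (hfC n)) (hint _ (hfC (n + 1))) (hfpos n) (hfpos (n + 1))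
        (hflog n) (hflog (n + 1)) (hfD n)
        ((hfD (n + 1)).trans (by
          gcongr D + ?_ ^ 2
          exact pow_le_pow_of_le_one (by norm_num) (by norm_num) (Nat.le_succ n)))
        (hmixD _ (hfC n) (hfpos n) (hflog n) _ (hfC (n + 1)) _ ⟨by norm_num, by norm_num⟩)
      refine le_trans (le_of_eq (integral_congr_ae (ae_of_all _ fun x => ?_))) this
      show |-_ - -_| = _
      rw [← abs_neg]
      ring_nf)
  have hpow : Tendsto (fun n : ℕ => D + ((1 / 2 : ℝ) ^ n) ^ 2) atTop (𝓝 D) := by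
    have h0 : Tendsto (fun n : ℕ => (1 / 2 : ℝ) ^ n) atTop (𝓝 0) :=
      tendsto_pow_atTop_nhds_zero_of_lt_one (by norm_num) (by norm_num)
    simpa using (h0.pow 2).const_add D
  refine ⟨u, hum, hui, ?_, fun g hg => ?_⟩
  · refine tendsto_nhds_unique hlim (tendsto_of_tendsto_of_tendsto_of_le_of_le
      tendsto_const_nhds hpow (fun n => ?_) hfD)
    exact hD _ (hfC n) (hfpos n) (hflog n)
  · have hgm := hmeas g hg
    refine lintegral_le_one_of_log_mix (by fun_prop)
      (fun x => mul_nonneg (hnn g hg x) (Real.exp_pos _).le) fun t ht => ?_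
    -- The gain from mixing in `g`, shifted by -log(1 - t). The shift makes it nonnegative, since
    -- the mixture is at least (1 - t)·f; near-minimality bounds its integral, and almost everywhere
    -- it converges to the integrand wanted.
    let φ : ℕ → Ω → ℝ≥0∞ := fun n x => ENNReal.ofReal
      (Real.log ((1 - t) * f (ns n) x + t * g x) - Real.log (f (ns n) x) - Real.log (1 - t))
    have hφm : ∀ n, Measurable (φ n) := fun n => by
      have := hmeas _ (hfC (ns n))
      fun_prop
    have hφle : ∀ n, ∫⁻ x, φ n x ∂ν ≤
        ENNReal.ofReal (((1 / 2 : ℝ) ^ (ns n)) ^ 2 - Real.log (1 - t)) := by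
      intro n
      have hli := integrable_log_mix ht.1 ht.2 (hmeas _ (hfC (ns n))) hgm (hnn g hg)
        (hint _ (hfC (ns n))) (hint g hg) (hfpos (ns n)) (hflog (ns n))
      have hi1 : Integrable (fun x => Real.log ((1 - t) * f (ns n) x + t * g x) -
          Real.log (f (ns n) x)) ν := hli.sub (hflog _)
      have hi2 : Integrable (fun x => Real.log ((1 - t) * f (ns n) x + t * g x) -
          Real.log (f (ns n) x) - Real.log (1 - t)) ν :=
        hi1.sub (integrable_const _)
      rw [← ofReal_integral_eq_lintegral_ofReal hi2]
      · refine ENNReal.ofReal_le_ofReal ?_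
        rw [integral_sub hi1 (integrable_const _), integral_sub hli (hflog _)]
        simp only [integral_const, probReal_univ, smul_eq_mul, one_mul]
        have h1 := hmixD _ (hfC (ns n)) (hfpos _) (hflog _) g hg t ht
        have h2 := hfD (ns n)
        rw [integral_neg] at h1 h2
        linarith
      · filter_upwards [hfpos (ns n)] with x hx
        show 0 ≤ _
        have hmul : Real.log (1 - t) + Real.log (f (ns n) x) =
            Real.log ((1 - t) * f (ns n) x) :=
          (Real.log_mul (by linarith [ht.2]) hx.ne').symm
        have h1 : 0 < (1 - t) * f (ns n) x := mul_pos (by linarith [ht.2]) hx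
        have := Real.log_le_log h1 (le_add_of_nonneg_right (mul_nonneg ht.1.le (hnn g hg x)))
        linarith
    have hφlim : ∀ᵐ x ∂ν, Tendsto (fun n => φ n x) atTop (𝓝 (ENNReal.ofReal
        (Real.log (1 - t + t * (g x * Real.exp (u x))) - Real.log (1 - t)))) := by
      have hall : ∀ᵐ x ∂ν, ∀ n, 0 < f n x := ae_all_iff.2 hfpos
      filter_upwards [hae, hall] with x hx hp
      refine (ENNReal.continuous_ofReal.tendsto _).comp (Tendsto.sub_const ?_ _)
      have hpos : 0 < 1 - t + t * (g x * Real.exp (u x)) :=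
        add_pos_of_pos_of_nonneg (by linarith [ht.2])
          (mul_nonneg ht.1.le (mul_nonneg (hnn g hg x) (Real.exp_pos _).le))
      have h1 : Tendsto (fun n => Real.log (1 - t + t * (g x * Real.exp (-Real.log (f (ns n) x)))))
          atTop (𝓝 (Real.log (1 - t + t * (g x * Real.exp (u x))))) :=
        (((((Real.continuous_exp.tendsto _).comp hx).const_mul (g x)).const_mul t).const_add
          (1 - t)).log hpos.ne'
      refine h1.congr fun n => ?_
      have hq := hp (ns n)
      have : 0 < (1 - t) * f (ns n) x + t * g x :=
        add_pos_of_pos_of_nonneg (mul_pos (by linarith [ht.2]) hq)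
          (mul_nonneg ht.1.le (hnn g hg x))
      rw [← Real.log_div this.ne' hq.ne', Real.exp_neg, Real.exp_log hq]
      congr 1
      field_simp
    have hlim2 : Tendsto (fun n => ENNReal.ofReal (((1 / 2 : ℝ) ^ (ns n)) ^ 2 - Real.log (1 - t)))
        atTop (𝓝 (ENNReal.ofReal (-Real.log (1 - t)))) := by
      refine (ENNReal.continuous_ofReal.tendsto _).comp ?_
      have h0 : Tendsto (fun n : ℕ => (1 / 2 : ℝ) ^ n) atTop (𝓝 0) :=
        tendsto_pow_atTop_nhds_zero_of_lt_one (by norm_num) (by norm_num)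
      simpa using (((h0.comp hns.tendsto_atTop).pow 2).sub_const (Real.log (1 - t)))
    calc ∫⁻ x, ENNReal.ofReal
          (Real.log (1 - t + t * (g x * Real.exp (u x))) - Real.log (1 - t)) ∂ν
        = ∫⁻ x, liminf (fun n => φ n x) atTop ∂ν :=
          lintegral_congr_ae (by filter_upwards [hφlim] with x hx using hx.liminf_eq.symm)
      _ ≤ liminf (fun n => ∫⁻ x, φ n x ∂ν) atTop := lintegral_liminf_le hφm
      _ ≤ liminf (fun n => ENNReal.ofReal (((1 / 2 : ℝ) ^ (ns n)) ^ 2 - Real.log (1 - t))) atTop :=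
          liminf_le_liminf (Eventually.of_forall hφle)
      _ = _ := hlim2.liminf_eq

end LogOptimal

/-! ### The numeraire attains the minimal divergence -/

section Duality

variable {Ω : Type*} [MeasurableSpace Ω]

lemma integrable_exp_of_lintegral_le_one {ν : Measure Ω} {a : Ω → ℝ}
    (ha : AEStronglyMeasurable a ν) (h : ∫⁻ x, ENNReal.ofReal (Real.exp (a x)) ∂ν ≤ 1) :
    Integrable (fun x => Real.exp (a x)) ν :=
  ⟨Real.continuous_exp.comp_aestronglyMeasurable ha, by
    rw [hasFiniteIntegral_iff_ofReal (ae_of_all _ fun x => (Real.exp_pos _).le)]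
    exact h.trans_lt ENNReal.one_lt_top⟩

/-- Jensen in the form 1 + (a - b) ≤ exp(a - b). Every comparison of mean logarithms below goes
through it. -/
lemma integral_le_integral_of_lintegral_exp_sub_le {ν : Measure Ω} [IsProbabilityMeasure ν]
    {a b : Ω → ℝ} (ha : Integrable a ν) (hb : Integrable b ν)
    (h : ∫⁻ x, ENNReal.ofReal (Real.exp (a x - b x)) ∂ν ≤ 1) :
    ∫ x, a x ∂ν ≤ ∫ x, b x ∂ν := by
  have hexp : Integrable (fun x => Real.exp (a x - b x)) ν :=
    integrable_exp_of_lintegral_le_one (ha.sub hb).aestronglyMeasurable h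
  have hle : ∫ x, Real.exp (a x - b x) ∂ν ≤ 1 := by
    rw [integral_eq_lintegral_of_nonneg_ae (ae_of_all _ fun x => (Real.exp_pos _).le)
      hexp.aestronglyMeasurable]
    exact ENNReal.toReal_le_of_le_ofReal zero_le_one (by simpa using h)
  have hmono : ∫ x, a x ∂ν ≤ ∫ x, (b x + Real.exp (a x - b x) - 1) ∂ν :=
    integral_mono ha ((hb.add hexp).sub (integrable_const _)) fun x => by
      have := Real.add_one_le_exp (a x - b x)
      show a x ≤ b x + Real.exp (a x - b x) - 1
      linarith
  have hbe : Integrable (fun x => b x + Real.exp (a x - b x)) ν := hb.add hexp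
  rw [integral_sub hbe (integrable_const _), integral_add hb hexp] at hmono
  simp only [integral_const, probReal_univ, smul_eq_mul, one_mul] at hmono
  linarith

/-- A function squeezed between integrable functions up to exponential moments. -/
lemma integrable_of_lintegral_exp_sub_le {ν : Measure Ω} {a b c : Ω → ℝ}
    (hm : AEStronglyMeasurable b ν) (ha : Integrable a ν) (hc : Integrable c ν)
    (hab : ∫⁻ x, ENNReal.ofReal (Real.exp (a x - b x)) ∂ν ≤ 1)
    (hbc : ∫⁻ x, ENNReal.ofReal (Real.exp (b x - c x)) ∂ν ≤ 1) : Integrable b ν := by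
  have h1 := integrable_exp_of_lintegral_le_one (ha.aestronglyMeasurable.sub hm) hab
  have h2 := integrable_exp_of_lintegral_le_one (hm.sub hc.aestronglyMeasurable) hbc
  refine (((ha.abs.add hc.abs).add h1).add h2).mono' hm (ae_of_all _ fun x => ?_)
  have e1 := Real.add_one_le_exp (a x - b x)
  have e2 := Real.add_one_le_exp (b x - c x)
  have e3 := Real.exp_pos (a x - b x)
  have e4 := Real.exp_pos (b x - c x)
  have := neg_abs_le (a x)
  have := le_abs_self (c x)
  have := abs_nonneg (a x)
  have := abs_nonneg (c x)
  rw [Real.norm_eq_abs, abs_le]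
  simp only [Pi.add_apply, Pi.sub_apply] at *
  constructor <;> linarith

/-- Only an inequality, since the part of `P` singular to `ν` is dropped; no absolute continuity is
needed. -/
lemma lintegral_mul_rnDeriv_le (ν P : Measure Ω) {g : Ω → ℝ≥0∞} (hg : Measurable g) :
    ∫⁻ x, g x * P.rnDeriv ν x ∂ν ≤ ∫⁻ x, g x ∂P := by
  calc ∫⁻ x, g x * P.rnDeriv ν x ∂ν = ∫⁻ x, g x ∂(ν.withDensity (P.rnDeriv ν)) := by
        rw [lintegral_withDensity_eq_lintegral_mul _ (P.measurable_rnDeriv ν) hg]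
        simp [mul_comm]
    _ ≤ _ := lintegral_mono' (P.withDensity_rnDeriv_le ν) le_rfl

lemma lintegral_mul_exp_neg_llr_le {ν P : Measure Ω} [SigmaFinite ν] [SigmaFinite P]
    (h : ν ≪ P) {g : Ω → ℝ≥0∞} (hg : Measurable g) :
    ∫⁻ x, g x * ENNReal.ofReal (Real.exp (-llr ν P x)) ∂ν ≤ ∫⁻ x, g x ∂P := by
  refine le_trans (lintegral_mono_ae ?_) (lintegral_mul_rnDeriv_le ν P hg)
  filter_upwards [exp_neg_llr h] with x hx
  rw [hx]
  gcongr
  exact ENNReal.ofReal_toReal_le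

lemma absolutelyContinuous_of_rnDeriv_pos {ν P : Measure Ω}
    (h : ∀ᵐ x ∂ν, 0 < P.rnDeriv ν x) : ν ≪ P :=
  (withDensity_absolutelyContinuous' (P.measurable_rnDeriv ν).aemeasurable
    (h.mono fun _ hx => hx.ne')).trans (P.withDensity_rnDeriv_le ν).absolutelyContinuous

lemma llr_ae_eq_neg_log_rnDeriv {ν P : Measure Ω} [SigmaFinite ν] [SigmaFinite P] (h : ν ≪ P) :
    llr ν P =ᵐ[ν] fun x => -Real.log (P.rnDeriv ν x).toReal := by
  filter_upwards [neg_llr h] with x hx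
  exact neg_eq_iff_eq_neg.1 hx

/-- Null members may charge sets that `P₁` ignores, but only where `L` vanishes. On {L ≠ 0} they may
be handled through densities with respect to `P₁`. -/
lemma restrict_ne_zero_absolutelyContinuous {P P₀ : Measure Ω} {L : Ω → ℝ≥0∞}
    (hL : Measurable L) (h : P ≪ P₀) : P.restrict {x | L x ≠ 0} ≪ P₀.withDensity L := by
  refine Measure.AbsolutelyContinuous.mk fun s hs h0 => ?_
  rw [withDensity_apply_eq_zero hL] at h0
  rw [Measure.restrict_apply hs, inter_comm]
  exact h h0

end Duality

/-! ### The minimal divergence and the log-optimal density for a convex null. -/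

lemma IsConvexFamily.exists_mix {S : Set (ProbabilityMeasure ℝ)} (hS : IsConvexFamily S)
    {P Q : ProbabilityMeasure ℝ} (hP : P ∈ S) (hQ : Q ∈ S) {t : ℝ≥0} (ht : t ≤ 1) :
    ∃ R ∈ S, (R : Measure ℝ) = (1 - t) • (P : Measure ℝ) + t • (Q : Measure ℝ) := by
  obtain ⟨R, hR, he⟩ := hS (mem_image_of_mem _ hP) (mem_image_of_mem _ hQ)
    zero_le zero_le (tsub_add_cancel_of_le ht)
  exact ⟨R, hR, he⟩

/-- The minimal divergence of `P₁` from the family `S`. -/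
def minDiv (S : Set (ProbabilityMeasure ℝ)) (P₁ : ProbabilityMeasure ℝ) : ℝ≥0∞ :=
  ⨅ P ∈ S, InformationTheory.klDiv (P₁ : Measure ℝ) (P : Measure ℝ)

lemma toReal_klDiv_eq {P Q : ProbabilityMeasure ℝ} (h : (P : Measure ℝ) ≪ Q) :
    (InformationTheory.klDiv (P : Measure ℝ) (Q : Measure ℝ)).toReal =
      ∫ x, llr (P : Measure ℝ) Q x ∂(P : Measure ℝ) :=
  InformationTheory.toReal_klDiv_of_measure_eq h (by simp)

lemma minDiv_toReal_le {S : Set (ProbabilityMeasure ℝ)} {P₁ P : ProbabilityMeasure ℝ} (hP : P ∈ S)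
    (hac : (P₁ : Measure ℝ) ≪ P) (hint : Integrable (llr (P₁ : Measure ℝ) P) P₁) :
    (minDiv S P₁).toReal ≤ ∫ x, llr (P₁ : Measure ℝ) P x ∂(P₁ : Measure ℝ) := by
  rw [← toReal_klDiv_eq hac]
  exact ENNReal.toReal_mono (InformationTheory.klDiv_ne_top hac hint) (iInf₂_le P hP)

lemma exists_integral_llr_lt {S : Set (ProbabilityMeasure ℝ)} {P₁ : ProbabilityMeasure ℝ}
    (hfin : minDiv S P₁ < ∞) {δ : ℝ} (hδ : 0 < δ) :
    ∃ P ∈ S, (P₁ : Measure ℝ) ≪ P ∧ Integrable (llr (P₁ : Measure ℝ) P) P₁ ∧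
      ∫ x, llr (P₁ : Measure ℝ) P x ∂(P₁ : Measure ℝ) < (minDiv S P₁).toReal + δ := by
  have hlt : minDiv S P₁ < minDiv S P₁ + ENNReal.ofReal δ :=
    ENNReal.lt_add_right hfin.ne (by simpa using hδ)
  obtain ⟨P, hP⟩ := iInf_lt_iff.1 hlt
  obtain ⟨hPS, hP⟩ := iInf_lt_iff.1 hP
  obtain ⟨hac, hint⟩ := InformationTheory.klDiv_ne_top_iff.1 (hP.trans_le le_top).ne
  refine ⟨P, hPS, hac, hint, ?_⟩
  rw [← toReal_klDiv_eq hac, ← ENNReal.toReal_ofReal hδ.le,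
    ← ENNReal.toReal_add hfin.ne ENNReal.ofReal_ne_top]
  exact (ENNReal.toReal_lt_toReal (hP.trans_le le_top).ne 
    (ENNReal.add_ne_top.2 ⟨hfin.ne, ENNReal.ofReal_ne_top⟩)).2 hP

/-- `exists_log_optimal` for the densities dP/dP₁ of the absolutely continuous parts. When such a
density is positive `P₁`-a.e., `P` dominates `P₁` and minus its logarithm is the log-likelihood
ratio, so the functional minimised is the divergence. -/
lemma exists_optimal_log_density {S : Set (ProbabilityMeasure ℝ)} {P₁ : ProbabilityMeasure ℝ}
    (hconvex : IsConvexFamily S) (hfin : minDiv S P₁ < ∞) :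
    ∃ u : ℝ → ℝ, Measurable u ∧ Integrable u P₁ ∧
      ∫ x, u x ∂(P₁ : Measure ℝ) = (minDiv S P₁).toReal ∧
      ∀ P ∈ S, ∫⁻ x, ENNReal.ofReal (Real.exp (u x)) * (P : Measure ℝ).rnDeriv P₁ x
        ∂(P₁ : Measure ℝ) ≤ 1 := by
  have hfinite : ∀ P : ProbabilityMeasure ℝ,
      ∀ᵐ x ∂(P₁ : Measure ℝ), (P : Measure ℝ).rnDeriv P₁ x < ∞ := fun P =>
    Measure.rnDeriv_lt_top _ _
  refine Exists.imp ?_ (exists_log_optimal (ν := (P₁ : Measure ℝ))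
    (C := {f | ∃ P ∈ S, f = fun x => ((P : Measure ℝ).rnDeriv P₁ x).toReal})
    (D := (minDiv S P₁).toReal) ?_ ?_ ?_ ?_ ?_ ?_)
  · rintro u ⟨hum, hui, huD, hu⟩
    refine ⟨hum, hui, huD, fun P hP => ?_⟩
    refine le_trans (le_of_eq (lintegral_congr_ae ?_)) (hu _ ⟨P, hP, rfl⟩)
    filter_upwards [hfinite P] with x hx
    rw [ENNReal.ofReal_mul ENNReal.toReal_nonneg, ENNReal.ofReal_toReal hx.ne, mul_comm]
  · rintro _ ⟨P, -, rfl⟩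
    exact (Measure.measurable_rnDeriv _ _).ennreal_toReal
  · rintro _ ⟨P, -, rfl⟩ x
    exact ENNReal.toReal_nonneg
  · rintro _ ⟨P, -, rfl⟩
    refine (lintegral_mono fun x => ENNReal.ofReal_toReal_le).trans ?_
    exact Measure.lintegral_rnDeriv_le.trans (by simp)
  · rintro _ ⟨P, hP, rfl⟩ _ ⟨Q, hQ, rfl⟩ t ht
    lift t to ℝ≥0 using ht.1.le
    have ht1 : t ≤ 1 := by exact_mod_cast ht.2.le
    obtain ⟨R, hR, he⟩ := hconvex.exists_mix hP hQ ht1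
    refine ⟨_, ⟨R, hR, rfl⟩, ?_⟩
    have h1 := Measure.rnDeriv_add ((1 - t) • (P : Measure ℝ)) (t • (Q : Measure ℝ))
      (P₁ : Measure ℝ)
    have h2 := Measure.rnDeriv_smul_left (P : Measure ℝ) (P₁ : Measure ℝ) (1 - t)
    have h3 := Measure.rnDeriv_smul_left (Q : Measure ℝ) (P₁ : Measure ℝ) t
    filter_upwards [h1, h2, h3, hfinite P, hfinite Q] with x e1 e2 e3 f1 f2
    rw [he, e1, Pi.add_apply, e2, e3]
    simp only [Pi.smul_apply, ENNReal.smul_def, smul_eq_mul]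
    rw [ENNReal.toReal_add (ENNReal.mul_ne_top ENNReal.coe_ne_top f1.ne)
      (ENNReal.mul_ne_top ENNReal.coe_ne_top f2.ne), ENNReal.toReal_mul,
      ENNReal.toReal_mul, ENNReal.coe_toReal, ENNReal.coe_toReal, NNReal.coe_sub ht1]
    rfl
  · rintro _ ⟨P, hP, rfl⟩ hpos hlog
    have hac : (P₁ : Measure ℝ) ≪ P :=
      absolutelyContinuous_of_rnDeriv_pos (hpos.mono fun x hx => (ENNReal.toReal_pos_iff.1 hx).1)
    have hneg := llr_ae_eq_neg_log_rnDeriv hac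
    rw [← integral_congr_ae hneg]
    exact minDiv_toReal_le hP hac (hlog.neg.congr hneg.symm)
  · intro δ hδ
    obtain ⟨P, hP, hac, hint, hlt⟩ := exists_integral_llr_lt hfin hδ
    have hneg := llr_ae_eq_neg_log_rnDeriv hac
    refine ⟨_, ⟨P, hP, rfl⟩, ?_, ?_, ?_⟩
    · filter_upwards [Measure.rnDeriv_pos' hac, hfinite P] with x h1 h2
      exact ENNReal.toReal_pos h1.ne' h2.ne
    · refine (hint.congr hneg).neg.congr (ae_of_all _ fun x => ?_)
      simp
    · rw [← integral_congr_ae hneg]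
      exact hlt.le

/-- `L` is a numeraire for `S` and the density of `P₁` with respect to the sub-probability `P₀`,
which dominates `S`. -/
structure IsNumeraireRatio (S : Set (ProbabilityMeasure ℝ)) (P₁ : ProbabilityMeasure ℝ)
    (P₀ : Measure ℝ) (L : ℝ → ℝ≥0∞) : Prop where
  mass_le : P₀ univ ≤ 1
  eq_withDensity : (P₁ : Measure ℝ) = P₀.withDensity L
  isNumeraire : IsNumeraire S P₁ L
  ac : ∀ P ∈ S, (P : Measure ℝ) ≪ P₀

lemma exists_mem_absolutelyContinuous {S : Set (ProbabilityMeasure ℝ)} {P₁ : ProbabilityMeasure ℝ}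
    (hfin : minDiv S P₁ < ∞) : ∃ P ∈ S, (P₁ : Measure ℝ) ≪ P :=
  let ⟨P, hP, hac, _⟩ := exists_integral_llr_lt hfin one_pos
  ⟨P, hP, hac⟩

lemma IsEVariable.ae_lt_top {S : Set (ProbabilityMeasure ℝ)} {B : ℝ → ℝ≥0∞} (h : IsEVariable S B)
    {P : ProbabilityMeasure ℝ} (hP : P ∈ S) : ∀ᵐ x ∂(P : Measure ℝ), B x < ∞ :=
  MeasureTheory.ae_lt_top h.1 ((h.2 P hP).trans_lt ENNReal.one_lt_top).ne

/-- Uniqueness of the Lebesgue decomposition identifies p₀/p₁ with 1/B, `P₁`-a.e. As `B` is finite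
there, `p₀` is nonzero where `p₁` is, so P₁ = L·P₀ and L = B `P₁`-a.e. Outside {p₁ ≠ 0} the ratio is
0, also as 0/0, so a part of a null member singular to `P₁` adds nothing to the expectation of `L`.
-/
theorem IsRIPr.isNumeraireRatio {S : Set (ProbabilityMeasure ℝ)} {P₁ : ProbabilityMeasure ℝ}
    (hfin : minDiv S P₁ < ∞) {P₀ : Measure ℝ} (hP₀ : IsRIPr S P₁ P₀)
    {μ : Measure ℝ} {p₀ p₁ : ℝ → ℝ≥0∞} (hp₀ : Measurable p₀) (hp₁ : Measurable p₁)
    (hd₀ : P₀ = μ.withDensity p₀) (hd₁ : (P₁ : Measure ℝ) = μ.withDensity p₁)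
    (hdef : ∀ P ∈ S, (P : Measure ℝ) ≪ P₀ + (P₁ : Measure ℝ)) :
    IsNumeraireRatio S P₁ P₀ (likelihoodRatio p₀ p₁) := by
  obtain ⟨hmass, B, hB, hder⟩ := hP₀
  have hLm : Measurable (likelihoodRatio p₀ p₁) := hp₁.div hp₀
  have hBtop : ∀ᵐ x ∂(P₁ : Measure ℝ), B x < ∞ := by
    obtain ⟨P, hP, hac⟩ := exists_mem_absolutelyContinuous hfin
    exact hac.ae_le (hB.1.ae_lt_top hP)
  have hp₀top : ∀ᵐ x ∂μ, p₀ x < ∞ := by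
    refine MeasureTheory.ae_lt_top hp₀ ?_
    rw [← setLIntegral_univ, ← withDensity_apply _ MeasurableSet.univ, ← hd₀]
    exact (hmass.trans_lt ENNReal.one_lt_top).ne
  have hp₁top : ∀ᵐ x ∂μ, p₁ x < ∞ := by
    refine MeasureTheory.ae_lt_top hp₁ ?_
    rw [← setLIntegral_univ, ← withDensity_apply _ MeasurableSet.univ, ← hd₁]
    simp
  have hp₁' : ∀ᵐ x ∂(P₁ : Measure ℝ), p₁ x ≠ 0 ∧ p₁ x < ∞ := by
    rw [hd₁, ae_withDensity_iff hp₁]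
    filter_upwards [hp₁top] with x hx h0 using ⟨h0, hx⟩
  have hAm : MeasurableSet {x | p₁ x = 0} := hp₁ (measurableSet_singleton 0)
  have hratio : (fun x => p₀ x / p₁ x) =ᵐ[(P₁ : Measure ℝ)] fun x => (B x)⁻¹ := by
    -- The decomposition is explicit: the singular part of `P₀` is its restriction to {p₁ = 0}.
    refine (Measure.eq_rnDeriv (s := P₀.restrict {x | p₁ x = 0}) (hp₀.div hp₁) ?_ ?_).trans hder
    · refine ⟨{x | p₁ x = 0}ᶜ, hAm.compl, by simp [Measure.restrict_apply hAm.compl], ?_⟩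
      rw [compl_compl]
      have : ∀ᵐ x ∂(P₁ : Measure ℝ), x ∉ {x | p₁ x = 0} := hp₁'.mono fun x hx => hx.1
      simpa [ae_iff] using this
    · conv_lhs => rw [← Measure.restrict_add_restrict_compl (μ := P₀) hAm]
      congr 1
      rw [hd₁, ← withDensity_mul _ hp₁ (hp₀.div hp₁), hd₀, restrict_withDensity hAm.compl,
        ← withDensity_indicator hAm.compl]
      refine withDensity_congr_ae ?_
      filter_upwards [hp₁top] with x hx
      by_cases h0 : p₁ x = 0
      · simp [h0]
      · rw [indicator_of_mem (by simpa using h0), Pi.mul_apply, Pi.div_apply, ENNReal.mul_div_cancel h0 hx.ne]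
  have hLB : likelihoodRatio p₀ p₁ =ᵐ[(P₁ : Measure ℝ)] B := by
    filter_upwards [hratio, hp₁'] with x hx hp
    have h1 : (p₀ x / p₁ x)⁻¹ = p₁ x / p₀ x :=
      ENNReal.inv_div (Or.inl hp.2.ne) (Or.inl hp.1)
    rw [likelihoodRatio, ← h1, hx, inv_inv]
  have hpos₀ : ∀ᵐ x ∂μ, p₁ x ≠ 0 → p₀ x ≠ 0 := by
    rw [← ae_withDensity_iff hp₁, ← hd₁]
    filter_upwards [hratio, hBtop] with x hx hb h0
    rw [h0, ENNReal.zero_div, eq_comm, ENNReal.inv_eq_zero] at hx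
    exact hb.ne hx
  have hwd : (P₁ : Measure ℝ) = P₀.withDensity (likelihoodRatio p₀ p₁) := by
    rw [hd₀, ← withDensity_mul _ hp₀ hLm, hd₁]
    refine withDensity_congr_ae ?_
    filter_upwards [hpos₀, hp₀top] with x h0 ht
    rw [Pi.mul_apply, likelihoodRatio]
    by_cases h1 : p₁ x = 0
    · simp [h1]
    · rw [ENNReal.mul_div_cancel (h0 h1) ht.ne]
  have hac : ∀ P ∈ S, (P : Measure ℝ) ≪ P₀ := fun P hP =>
    (hdef P hP).trans (Measure.AbsolutelyContinuous.rfl.add_left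
      (hwd ▸ withDensity_absolutelyContinuous _ _))
  refine ⟨hmass, hwd, ⟨⟨hLm, fun P hP => ?_⟩, ?_, fun B' hB' => ?_⟩, hac⟩
  · have hsm : MeasurableSet {x | likelihoodRatio p₀ p₁ x ≠ 0} :=
      (hLm (measurableSet_singleton 0)).compl
    have hrac : (P : Measure ℝ).restrict {x | likelihoodRatio p₀ p₁ x ≠ 0} ≪ P₁ :=
      hwd ▸ restrict_ne_zero_absolutelyContinuous hLm (hac P hP)
    calc ∫⁻ x, likelihoodRatio p₀ p₁ x ∂(P : Measure ℝ)
        = ∫⁻ x in {x | likelihoodRatio p₀ p₁ x ≠ 0}, likelihoodRatio p₀ p₁ x ∂(P : Measure ℝ) :=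
          (setLIntegral_eq_of_support_subset fun x hx => hx).symm
      _ = ∫⁻ x in {x | likelihoodRatio p₀ p₁ x ≠ 0}, B x ∂(P : Measure ℝ) :=
          lintegral_congr_ae (hrac.ae_le hLB)
      _ ≤ ∫⁻ x, B x ∂(P : Measure ℝ) := setLIntegral_le_lintegral _ _
      _ ≤ 1 := hB.1.2 P hP
  · filter_upwards [hLB, hB.2.1] with x h1 h2
    rwa [h1]
  · refine le_trans (le_of_eq (lintegral_congr_ae ?_)) (hB.2.2 B' hB')
    filter_upwards [hLB] with x h1
    rw [h1]

namespace IsNumeraireRatio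

variable {S : Set (ProbabilityMeasure ℝ)} {P₁ : ProbabilityMeasure ℝ} {P₀ : Measure ℝ}
  {L : ℝ → ℝ≥0∞}

lemma measurable (h : IsNumeraireRatio S P₁ P₀ L) : Measurable L := h.isNumeraire.1.1

lemma measurable_toReal (h : IsNumeraireRatio S P₁ P₀ L) : Measurable fun x => (L x).toReal :=
  h.measurable.ennreal_toReal

lemma ae_pos_lt_top (h : IsNumeraireRatio S P₁ P₀ L) (hfin : minDiv S P₁ < ∞) :
    ∀ᵐ x ∂(P₁ : Measure ℝ), 0 < L x ∧ L x < ∞ := by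
  obtain ⟨P, hP, hac⟩ := exists_mem_absolutelyContinuous hfin
  filter_upwards [h.isNumeraire.2.1, hac.ae_le (h.isNumeraire.1.ae_lt_top hP)] with x h1 h2
    using ⟨h1, h2⟩

/-- exp(u) is controlled only on the part of `P` absolutely continuous to `P₁`. Cutting it off to {L
≠ 0} makes it an e-variable, and `P₁` does not see the cut, so the numeraire property applies. -/
lemma lintegral_exp_sub_log_le (h : IsNumeraireRatio S P₁ P₀ L) (hfin : minDiv S P₁ < ∞)
    {u : ℝ → ℝ} (hu : Measurable u)
    (hone : ∀ P ∈ S, ∫⁻ x, ENNReal.ofReal (Real.exp (u x)) * (P : Measure ℝ).rnDeriv P₁ x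
        ∂(P₁ : Measure ℝ) ≤ 1) :
    ∫⁻ x, ENNReal.ofReal (Real.exp (u x - Real.log (L x).toReal)) ∂(P₁ : Measure ℝ) ≤ 1 := by
  have hLm := h.measurable
  have hsm : MeasurableSet {x | L x ≠ 0} := (hLm (measurableSet_singleton 0)).compl
  have hE : IsEVariable S ({x | L x ≠ 0}.indicator fun x => ENNReal.ofReal (Real.exp (u x))) := by
    refine ⟨Measurable.indicator (by fun_prop) hsm, fun P hP => ?_⟩
    have hrac : (P : Measure ℝ).restrict {x | L x ≠ 0} ≪ P₁ :=
      h.eq_withDensity ▸ restrict_ne_zero_absolutelyContinuous hLm (h.ac P hP)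
    rw [lintegral_indicator hsm, ← lintegral_rnDeriv_mul hrac (by fun_prop)]
    refine le_trans (lintegral_mono_ae ?_) (hone P hP)
    filter_upwards [Measure.rnDeriv_restrict (P : Measure ℝ) (P₁ : Measure ℝ) hsm] with x hx
    rw [hx, mul_comm]
    gcongr
    exact indicator_le_self' (fun _ _ => zero_le) x
  refine le_trans (le_of_eq (lintegral_congr_ae ?_)) (h.isNumeraire.2.2 _ hE)
  filter_upwards [h.ae_pos_lt_top hfin] with x hx
  have hpos : 0 < (L x).toReal := ENNReal.toReal_pos hx.1.ne' hx.2.ne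
  rw [indicator_of_mem (by exact hx.1.ne'), Real.exp_sub, Real.exp_log hpos,
    ENNReal.ofReal_div_of_pos hpos, ENNReal.ofReal_toReal hx.2.ne]

lemma lintegral_exp_log_sub_llr_le (h : IsNumeraireRatio S P₁ P₀ L) (hfin : minDiv S P₁ < ∞)
    {P : ProbabilityMeasure ℝ} (hP : P ∈ S) (hac : (P₁ : Measure ℝ) ≪ P) :
    ∫⁻ x, ENNReal.ofReal (Real.exp (Real.log (L x).toReal - llr (P₁ : Measure ℝ) P x))
      ∂(P₁ : Measure ℝ) ≤ 1 := by
  refine le_trans (le_of_eq (lintegral_congr_ae ?_))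
    ((lintegral_mul_exp_neg_llr_le hac h.measurable).trans (h.isNumeraire.1.2 P hP))
  filter_upwards [h.ae_pos_lt_top hfin] with x hx
  have hpos : 0 < (L x).toReal := ENNReal.toReal_pos hx.1.ne' hx.2.ne
  rw [sub_eq_add_neg, Real.exp_add, Real.exp_log hpos, ENNReal.ofReal_mul hpos.le,
    ENNReal.ofReal_toReal hx.2.ne]

theorem integrable_log (h : IsNumeraireRatio S P₁ P₀ L) (hconvex : IsConvexFamily S)
    (hfin : minDiv S P₁ < ∞) : Integrable (fun x => Real.log (L x).toReal) P₁ := by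
  obtain ⟨u, hum, hui, -, hu⟩ := exists_optimal_log_density hconvex hfin
  obtain ⟨P, hP, hac, hint, -⟩ := exists_integral_llr_lt hfin one_pos
  exact integrable_of_lintegral_exp_sub_le h.measurable_toReal.log.aestronglyMeasurable hui hint
    (h.lintegral_exp_sub_log_le hfin hum hu) (h.lintegral_exp_log_sub_llr_le hfin hP hac)

/-- Duality: any null `P` dominating `P₁` with integrable log-likelihood ratio bounds the mean log
from above, and the log-optimal `u` bounds it from below by exactly `D`. -/
theorem integral_log_eq (h : IsNumeraireRatio S P₁ P₀ L) (hconvex : IsConvexFamily S)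
    (hfin : minDiv S P₁ < ∞) :
    ∫ x, Real.log (L x).toReal ∂(P₁ : Measure ℝ) = (minDiv S P₁).toReal := by
  have hlog := h.integrable_log hconvex hfin
  refine le_antisymm (le_of_forall_pos_le_add fun δ hδ => ?_) ?_
  · obtain ⟨P, hP, hac, hint, hlt⟩ := exists_integral_llr_lt hfin hδ
    exact (integral_le_integral_of_lintegral_exp_sub_le hlog hint
      (h.lintegral_exp_log_sub_llr_le hfin hP hac)).trans hlt.le
  · obtain ⟨u, hum, hui, huD, hu⟩ := exists_optimal_log_density hconvex hfin
    rw [← huD]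
    exact integral_le_integral_of_lintegral_exp_sub_le hui hlog
      (h.lintegral_exp_sub_log_le hfin hum hu)

end IsNumeraireRatio

/-! ### Mean logarithms and growth rates -/

section MeanLog

variable {Ω : Type*} [MeasurableSpace Ω] {μ : Measure Ω} {M : Ω → ℝ}

lemma log_ofReal_toENNReal {y : ℝ} (hy : 0 < y) :
    (ENNReal.log (ENNReal.ofReal y)).toENNReal = ENNReal.ofReal (Real.log y) := by
  rw [ENNReal.log_ofReal_of_pos hy, EReal.real_coe_toENNReal]

lemma neg_log_ofReal_toENNReal {y : ℝ} (hy : 0 < y) :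
    (-ENNReal.log (ENNReal.ofReal y)).toENNReal = ENNReal.ofReal (-Real.log y) := by
  rw [ENNReal.log_ofReal_of_pos hy, ← EReal.coe_neg, EReal.real_coe_toENNReal]

lemma meanLog_eq_integral (hpos : ∀ᵐ x ∂μ, 0 < M x)
    (hint : Integrable (fun x => Real.log (M x)) μ) :
    meanLog μ M = ((∫ x, Real.log (M x) ∂μ : ℝ) : EReal) := by
  have h1 : ∫⁻ x, (ENNReal.log (ENNReal.ofReal (M x))).toENNReal ∂μ =
      ∫⁻ x, ENNReal.ofReal (Real.log (M x)) ∂μ :=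
    lintegral_congr_ae (hpos.mono fun x hx => log_ofReal_toENNReal hx)
  have h2 : ∫⁻ x, (-ENNReal.log (ENNReal.ofReal (M x))).toENNReal ∂μ =
      ∫⁻ x, ENNReal.ofReal (-Real.log (M x)) ∂μ :=
    lintegral_congr_ae (hpos.mono fun x hx => neg_log_ofReal_toENNReal hx)
  rw [meanLog, h1, h2, integral_eq_lintegral_pos_part_sub_lintegral_neg_part hint, EReal.coe_sub,
    EReal.coe_ennreal_toReal, EReal.coe_ennreal_toReal]
  · exact hint.neg.lintegral_lt_top.ne
  · exact hint.lintegral_lt_top.ne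

/-- Jensen when `M` may vanish. The positive part of log M is always integrable, since log M ≤ |l| +
M·exp(-l). If the negative part has infinite integral the mean is -∞; otherwise `M` is positive a.e.
and the real-valued version applies. -/
lemma meanLog_le_integral [IsProbabilityMeasure μ] (hM : Measurable M) (hM0 : ∀ x, 0 ≤ M x)
    {l : Ω → ℝ} (hl : Integrable l μ)
    (h : ∫⁻ x, ENNReal.ofReal (M x) * ENNReal.ofReal (Real.exp (-l x)) ∂μ ≤ 1) :
    meanLog μ M ≤ ((∫ x, l x ∂μ : ℝ) : EReal) := by
  have hup : ∫⁻ x, (ENNReal.log (ENNReal.ofReal (M x))).toENNReal ∂μ < ∞ := by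
    have hb : ∀ x, (ENNReal.log (ENNReal.ofReal (M x))).toENNReal ≤
        ENNReal.ofReal |l x| + ENNReal.ofReal (M x) * ENNReal.ofReal (Real.exp (-l x)) := by
      intro x
      rcases (hM0 x).eq_or_lt with h0 | h0
      · rw [← h0]
        simp
      · rw [log_ofReal_toENNReal h0, ← ENNReal.ofReal_mul h0.le,
          ← ENNReal.ofReal_add (abs_nonneg _) (by positivity)]
        refine ENNReal.ofReal_le_ofReal ?_
        have := Real.add_one_le_exp (Real.log (M x) - l x)
        rw [sub_eq_add_neg, Real.exp_add, Real.exp_log h0] at this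
        have := le_abs_self (l x)
        linarith
    refine (lintegral_mono hb).trans_lt ?_
    rw [lintegral_add_right' _ (by
      exact (hM.ennreal_ofReal.aemeasurable).mul
        (Real.measurable_exp.comp_aemeasurable hl.aemeasurable.neg).ennreal_ofReal)]
    refine ENNReal.add_lt_top.2 ⟨hl.abs.lintegral_lt_top, h.trans_lt ENNReal.one_lt_top⟩
  by_cases hdown : ∫⁻ x, (-ENNReal.log (ENNReal.ofReal (M x))).toENNReal ∂μ = ∞
  · rw [meanLog, hdown, EReal.coe_ennreal_top, EReal.sub_top]
    exact bot_le
  have hmeas : Measurable fun x => (-ENNReal.log (ENNReal.ofReal (M x))).toENNReal := by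
    fun_prop
  have hpos : ∀ᵐ x ∂μ, 0 < M x := by
    filter_upwards [ae_lt_top hmeas hdown] with x hx
    refine (hM0 x).lt_of_ne fun h0 => ?_
    rw [← h0] at hx
    simp at hx
  have h1 : ∫⁻ x, (ENNReal.log (ENNReal.ofReal (M x))).toENNReal ∂μ =
      ∫⁻ x, ENNReal.ofReal (Real.log (M x)) ∂μ :=
    lintegral_congr_ae (hpos.mono fun x hx => log_ofReal_toENNReal hx)
  have h2 : ∫⁻ x, (-ENNReal.log (ENNReal.ofReal (M x))).toENNReal ∂μ =
      ∫⁻ x, ENNReal.ofReal (-Real.log (M x)) ∂μ :=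
    lintegral_congr_ae (hpos.mono fun x hx => neg_log_ofReal_toENNReal hx)
  have hint : Integrable (fun x => Real.log (M x)) μ := by
    refine ⟨hM.log.aestronglyMeasurable, ?_⟩
    rw [h1] at hup
    rw [h2] at hdown
    have hle : ∀ x, ‖Real.log (M x)‖ₑ ≤
        ENNReal.ofReal (Real.log (M x)) + ENNReal.ofReal (-Real.log (M x)) := by
      intro x
      rw [Real.enorm_eq_ofReal_abs]
      rcases le_total 0 (Real.log (M x)) with h0 | h0
      · rw [abs_of_nonneg h0]
        exact le_self_add
      · rw [abs_of_nonpos h0]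
        exact le_add_self
    refine (lintegral_mono hle).trans_lt ?_
    rw [lintegral_add_left hM.log.ennreal_ofReal]
    exact ENNReal.add_lt_top.2 ⟨hup, lt_top_iff_ne_top.2 hdown⟩
  rw [meanLog_eq_integral hpos hint, EReal.coe_le_coe_iff]
  refine integral_le_integral_of_lintegral_exp_sub_le hint hl
    (le_trans (le_of_eq (lintegral_congr_ae ?_)) h)
  filter_upwards [hpos] with x hx
  rw [sub_eq_add_neg, Real.exp_add, Real.exp_log hx, ENNReal.ofReal_mul hx.le]

end MeanLog

/-! ### Products of a fixed bet over i.i.d. observations. -/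

section IID

variable (Q : ProbabilityMeasure ℝ)

instance : IsProbabilityMeasure (iidLaw Q) := by
  unfold iidLaw
  infer_instance

lemma measurePreserving_eval_iidLaw (i : ℕ) :
    MeasurePreserving (fun x : ℕ → ℝ => x i) (iidLaw Q) (Q : Measure ℝ) :=
  measurePreserving_eval_infinitePi _ i

lemma iIndepFun_iidLaw {β : Type*} [MeasurableSpace β] {f : ℝ → β} (hf : Measurable f) :
    iIndepFun (fun (i : ℕ) (x : ℕ → ℝ) => f (x i)) (iidLaw Q) :=
  iIndepFun_infinitePi (P := fun _ : ℕ => (Q : Measure ℝ)) fun _ => hf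

variable {Q}

lemma integrable_comp_eval {f : ℝ → ℝ} (hf : Integrable f Q) (i : ℕ) :
    Integrable (fun x : ℕ → ℝ => f (x i)) (iidLaw Q) :=
  (measurePreserving_eval_iidLaw Q i).integrable_comp_of_integrable hf

lemma integral_comp_eval {f : ℝ → ℝ} (hf : Measurable f) (i : ℕ) :
    ∫ x, f (x i) ∂(iidLaw Q) = ∫ y, f y ∂(Q : Measure ℝ) := by
  have hmp := measurePreserving_eval_iidLaw Q i
  rw [← hmp.map_eq, integral_map hmp.measurable.aemeasurable hf.aestronglyMeasurable]

lemma integrable_sum_eval {f : ℝ → ℝ} (hf : Integrable f Q) (n : ℕ) :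
    Integrable (fun x : ℕ → ℝ => ∑ i ∈ Finset.range n, f (x i)) (iidLaw Q) :=
  integrable_finsetSum _ fun i _ => integrable_comp_eval hf i

lemma integral_sum_eval {f : ℝ → ℝ} (hfm : Measurable f) (hf : Integrable f Q) (n : ℕ) :
    ∫ x, ∑ i ∈ Finset.range n, f (x i) ∂(iidLaw Q) = n * ∫ y, f y ∂(Q : Measure ℝ) := by
  rw [integral_finsetSum _ fun i _ => integrable_comp_eval hf i]
  simp [integral_comp_eval hfm]

lemma strongLaw_iidLaw {f : ℝ → ℝ} (hfm : Measurable f) (hf : Integrable f Q) :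
    ∀ᵐ x ∂(iidLaw Q), Tendsto (fun n : ℕ => (∑ i ∈ Finset.range n, f (x i)) / (n : ℝ)) atTop
      (𝓝 (∫ y, f y ∂(Q : Measure ℝ))) := by
  have h := strong_law_ae_real (μ := iidLaw Q) (fun (i : ℕ) (x : ℕ → ℝ) => f (x i))
    (integrable_comp_eval hf 0) (fun i j hij => (iIndepFun_iidLaw Q hfm).indepFun hij)
    (fun i => ⟨(hfm.comp (measurable_pi_apply i)).aemeasurable,
      (hfm.comp (measurable_pi_apply 0)).aemeasurable, by
        have e : ∀ i : ℕ, Measure.map (fun x : ℕ → ℝ => f (x i)) (iidLaw Q) =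
            Measure.map f (Q : Measure ℝ) := fun i => by
          rw [← (measurePreserving_eval_iidLaw Q i).map_eq,
            Measure.map_map hfm (measurable_pi_apply i)]
          rfl
        rw [e i, e 0]⟩)
  simpa only [integral_comp_eval hfm] using h

variable {b : ℝ → ℝ}

lemma ae_forall_eval_pos (hpos : ∀ᵐ y ∂(Q : Measure ℝ), 0 < b y) :
    ∀ᵐ x ∂(iidLaw Q), ∀ i : ℕ, 0 < b (x i) :=
  ae_all_iff.2 fun i => (measurePreserving_eval_iidLaw Q i).quasiMeasurePreserving.ae hpos

lemma meanLog_prod_eval (hb : Measurable b) (hpos : ∀ᵐ y ∂(Q : Measure ℝ), 0 < b y)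
    (hlog : Integrable (fun y => Real.log (b y)) Q) (n : ℕ) :
    meanLog (iidLaw Q) (fun x => ∏ i ∈ Finset.range n, b (x i)) =
      ((n * ∫ y, Real.log (b y) ∂(Q : Measure ℝ) : ℝ) : EReal) := by
  have hae := ae_forall_eval_pos hpos
  have heq : (fun x : ℕ → ℝ => ∑ i ∈ Finset.range n, Real.log (b (x i))) =ᵐ[iidLaw Q]
      fun x => Real.log (∏ i ∈ Finset.range n, b (x i)) := by
    filter_upwards [hae] with x hx
    rw [Real.log_prod fun i _ => (hx i).ne']
  rw [meanLog_eq_integral, ← integral_congr_ae heq, integral_sum_eval hb.log hlog]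
  · filter_upwards [hae] with x hx
    exact Finset.prod_pos fun i _ => hx i
  · exact (integrable_sum_eval hlog n).congr heq

lemma tendsto_meanLog_prod_eval (hb : Measurable b) (hpos : ∀ᵐ y ∂(Q : Measure ℝ), 0 < b y)
    (hlog : Integrable (fun y => Real.log (b y)) Q) :
    Tendsto (fun n : ℕ => meanLog (iidLaw Q) (fun x => ∏ i ∈ Finset.range n, b (x i)) /
      (n : EReal)) atTop (𝓝 ((∫ y, Real.log (b y) ∂(Q : Measure ℝ) : ℝ) : EReal)) := by
  refine tendsto_const_nhds.congr' ?_
  filter_upwards [eventually_gt_atTop 0] with n hn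
  have hn' : (n : ℝ) ≠ 0 := by exact_mod_cast hn.ne'
  rw [meanLog_prod_eval hb hpos hlog, ← EReal.coe_natCast, ← EReal.coe_div,
    mul_div_cancel_left₀ _ hn']

lemma tendsto_log_prod_eval (hb : Measurable b) (hpos : ∀ᵐ y ∂(Q : Measure ℝ), 0 < b y)
    (hlog : Integrable (fun y => Real.log (b y)) Q) :
    ∀ᵐ x ∂(iidLaw Q), Tendsto (fun n : ℕ => Real.log (∏ i ∈ Finset.range n, b (x i)) / (n : ℝ))
      atTop (𝓝 (∫ y, Real.log (b y) ∂(Q : Measure ℝ))) := by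
  filter_upwards [strongLaw_iidLaw hb.log hlog, ae_forall_eval_pos hpos] with x h1 h2
  refine h1.congr fun n => ?_
  rw [Real.log_prod fun i _ => (h2 i).ne']

lemma growthRateAt_prod_eval (hb : Measurable b) (hpos : ∀ᵐ y ∂(Q : Measure ℝ), 0 < b y)
    (hlog : Integrable (fun y => Real.log (b y)) Q) :
    growthRateAt Q (fun n x => ∏ i ∈ Finset.range n, b (x i)) =
      ((∫ y, Real.log (b y) ∂(Q : Measure ℝ) : ℝ) : EReal) :=
  (tendsto_meanLog_prod_eval hb hpos hlog).limsup_eq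

end IID

/-! ### Test supermartingales -/

lemma measurable_eval_obsFiltration {i n : ℕ} (h : i < n) :
    Measurable[obsFiltration n] fun x : ℕ → ℝ => x i :=
  (comap_measurable _).mono (le_iSup (fun j : Fin n =>
    MeasurableSpace.comap (fun x : ℕ → ℝ => x j) inferInstance) ⟨i, h⟩) le_rfl

lemma measurable_prod_eval_obsFiltration {b : ℝ → ℝ} (hb : Measurable b) (n : ℕ) :
    Measurable[obsFiltration n] fun x : ℕ → ℝ => ∏ i ∈ Finset.range n, b (x i) :=
  Finset.measurable_fun_prod _ fun _ hi =>
    hb.comp (measurable_eval_obsFiltration (Finset.mem_range.1 hi))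

lemma indep_eval_obsFiltration (Q : ProbabilityMeasure ℝ) (n : ℕ) :
    Indep (MeasurableSpace.comap (fun x : ℕ → ℝ => x n) inferInstance) (obsFiltration n)
      (iidLaw Q) := by
  have h : iIndep (fun i : ℕ => MeasurableSpace.comap (fun x : ℕ → ℝ => x i) inferInstance)
      (iidLaw Q) := (iIndepFun_iidLaw Q measurable_id).iIndep
  -- Indices start at 0: at time `n` the coordinates below `n` are known, and coordinate `n` is the
  -- next one.
  have h2 := indep_iSup_of_disjoint (fun i : ℕ => (measurable_pi_apply i).comap_le) h
    (S := {n}) (T := Iio n) (by simp)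
  refine indep_of_indep_of_le h2 ?_ (iSup_le fun i => ?_)
  · exact le_biSup (fun i : ℕ => MeasurableSpace.comap (fun x : ℕ → ℝ => x i) inferInstance)
      (mem_singleton n)
  · exact le_biSup (fun i : ℕ => MeasurableSpace.comap (fun x : ℕ → ℝ => x i) inferInstance)
      (mem_Iio.2 i.2)

lemma lintegral_prod_eval (Q : ProbabilityMeasure ℝ) {f : ℝ → ℝ≥0∞} (hf : Measurable f) (n : ℕ) :
    ∫⁻ x, ∏ i ∈ Finset.range n, f (x i) ∂(iidLaw Q) = (∫⁻ y, f y ∂(Q : Measure ℝ)) ^ n := by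
  rw [lintegral_prod_eq_prod_lintegral_of_indepFun _ (fun (i : ℕ) (x : ℕ → ℝ) => f (x i))
    (iIndepFun_iidLaw Q hf) fun i => hf.comp (measurable_pi_apply i)]
  simp [(measurePreserving_eval_iidLaw Q _).lintegral_comp hf]

/-- The first `n` factors are known and come out of the conditional expectation; the next factor is
independent of them with mean at most 1. -/
lemma supermartingale_prod_eval {P : ProbabilityMeasure ℝ} {b : ℝ → ℝ} (hb : Measurable b)
    (hb0 : ∀ y, 0 ≤ b y) (hone : ∫⁻ y, ENNReal.ofReal (b y) ∂(P : Measure ℝ) ≤ 1) :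
    Supermartingale (fun n (x : ℕ → ℝ) => ∏ i ∈ Finset.range n, b (x i)) obsFiltration
      (iidLaw P) := by
  have hint : ∀ n, Integrable (fun x : ℕ → ℝ => ∏ i ∈ Finset.range n, b (x i)) (iidLaw P) := by
    intro n
    refine integrable_of_lintegral_ofReal_le_one (by fun_prop)
      (fun x => Finset.prod_nonneg fun i _ => hb0 _) ?_
    simp only [ENNReal.ofReal_prod_of_nonneg fun i _ => hb0 _]
    rw [lintegral_prod_eval P hb.ennreal_ofReal]
    exact pow_le_one' hone n
  have hbi : Integrable b P := integrable_of_lintegral_ofReal_le_one hb hb0 hone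
  have hb1 : ∫ y, b y ∂(P : Measure ℝ) ≤ 1 := by
    rw [integral_eq_lintegral_of_nonneg_ae (ae_of_all _ hb0) hb.aestronglyMeasurable]
    exact ENNReal.toReal_le_of_le_ofReal zero_le_one (by simpa using hone)
  refine supermartingale_nat
    (fun n => (measurable_prod_eval_obsFiltration hb n).stronglyMeasurable) hint fun n => ?_
  have hsplit : (fun x : ℕ → ℝ => ∏ i ∈ Finset.range (n + 1), b (x i)) =
      (fun x : ℕ → ℝ => ∏ i ∈ Finset.range n, b (x i)) * fun x => b (x n) := by
    ext x
    simp [Finset.prod_range_succ]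
  have hpull := condExp_mul_of_stronglyMeasurable_left (μ := iidLaw P)
    (measurable_prod_eval_obsFiltration hb n).stronglyMeasurable (g := fun x => b (x n))
    (by rw [← hsplit]; exact hint (n + 1)) (integrable_comp_eval hbi n)
  have hind := condExp_indep_eq (μ := iidLaw P) (f := fun x : ℕ → ℝ => b (x n))
    (measurable_pi_apply n).comap_le (obsFiltration.le n)
    (hb.comp (comap_measurable _)).stronglyMeasurable (indep_eval_obsFiltration P n)
  rw [hsplit]
  filter_upwards [hpull, hind] with x h1 h2
  rw [h1, Pi.mul_apply, h2, integral_comp_eval hb]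
  exact mul_le_of_le_one_right (Finset.prod_nonneg fun i _ => hb0 _) hb1

/-! ### Change of measure on finitely many observations. -/

section ChangeOfMeasure

variable {ι : Type*} [Fintype ι]

lemma pi_eq_withDensity_prod_rnDeriv (Q P : ProbabilityMeasure ℝ) (h : (Q : Measure ℝ) ≪ P) :
    (Measure.pi fun _ : ι => (Q : Measure ℝ)) =
      (Measure.pi fun _ : ι => (P : Measure ℝ)).withDensity
        fun y => ∏ i, (Q : Measure ℝ).rnDeriv P (y i) := by
  refine Measure.pi_eq fun s hs => ?_
  have hbox : MeasurableSet (univ.pi s) := MeasurableSet.univ_pi hs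
  have hg : Measurable ((Q : Measure ℝ).rnDeriv P) := Measure.measurable_rnDeriv _ _
  rw [withDensity_apply _ hbox, ← lintegral_indicator hbox]
  have hind : (univ.pi s).indicator (fun y : ι → ℝ => ∏ i, (Q : Measure ℝ).rnDeriv P (y i)) =
      fun y => ∏ i, (s i).indicator ((Q : Measure ℝ).rnDeriv P) (y i) := by
    classical
    ext y
    by_cases hy : y ∈ univ.pi s
    · rw [indicator_of_mem hy]
      exact Finset.prod_congr rfl fun i _ => (indicator_of_mem (hy i (mem_univ i)) _).symm
    · rw [indicator_of_notMem hy]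
      obtain ⟨i, hi⟩ : ∃ i, y i ∉ s i := by simpa [Set.mem_pi] using hy
      exact (Finset.prod_eq_zero (Finset.mem_univ i) (indicator_of_notMem hi _)).symm
  rw [hind, lintegral_prod_eq_prod_lintegral_of_indepFun Finset.univ
    (fun (i : ι) (y : ι → ℝ) => (s i).indicator ((Q : Measure ℝ).rnDeriv P) (y i))
    (iIndepFun_pi fun i => (hg.indicator (hs i)).aemeasurable)
    fun i => (hg.indicator (hs i)).comp (measurable_pi_apply i)]
  refine Finset.prod_congr rfl fun i _ => ?_
  rw [(measurePreserving_eval (fun _ : ι => (P : Measure ℝ)) i).lintegral_comp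
    (hg.indicator (hs i)), lintegral_indicator (hs i), Measure.setLIntegral_rnDeriv h]

lemma lintegral_pi_mul_exp_neg_llr_le {Q P : ProbabilityMeasure ℝ} (h : (Q : Measure ℝ) ≪ P)
    {g : (ι → ℝ) → ℝ≥0∞} (hg : Measurable g) :
    ∫⁻ y, g y * ∏ i, ENNReal.ofReal (Real.exp (-llr (Q : Measure ℝ) P (y i)))
      ∂(Measure.pi fun _ : ι => (Q : Measure ℝ)) ≤
      ∫⁻ y, g y ∂(Measure.pi fun _ : ι => (P : Measure ℝ)) := by
  have hr : Measurable ((Q : Measure ℝ).rnDeriv P) := Measure.measurable_rnDeriv _ _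
  have hl := measurable_llr (Q : Measure ℝ) (P : Measure ℝ)
  have hprod : Measurable fun y : ι → ℝ => ∏ i, (Q : Measure ℝ).rnDeriv P (y i) :=
    Finset.measurable_fun_prod _ fun i _ => hr.comp (measurable_pi_apply i)
  rw [pi_eq_withDensity_prod_rnDeriv Q P h,
    lintegral_withDensity_eq_lintegral_mul _ hprod (by fun_prop)]
  have hfin : ∀ᵐ y ∂(Measure.pi fun _ : ι => (P : Measure ℝ)), ∀ i,
      (Q : Measure ℝ).rnDeriv P (y i) < ∞ := ae_all_iff.2 fun i =>
    (Measure.quasiMeasurePreserving_eval (fun _ : ι => (P : Measure ℝ)) i).ae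
      (Measure.rnDeriv_lt_top _ _)
  refine lintegral_mono_ae ?_
  filter_upwards [hfin] with y hy
  rw [Pi.mul_apply, mul_left_comm, ← Finset.prod_mul_distrib]
  -- Each factor is r·exp(-log r), equal to 1 where the density `r` is positive. Where r = 0 the
  -- convention log 0 = 0 leaves 0·1 = 0, which is why only an inequality holds.
  refine mul_le_of_le_one_right' (Finset.prod_le_one' fun i _ => ?_)
  rw [llr_def]
  by_cases h0 : (Q : Measure ℝ).rnDeriv P (y i) = 0
  · simp [h0]
  · have hpos := ENNReal.toReal_pos h0 (hy i).ne
    rw [Real.exp_neg, Real.exp_log hpos, ENNReal.ofReal_inv_of_pos hpos,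
      ENNReal.ofReal_toReal (hy i).ne, ENNReal.mul_inv_cancel h0 (hy i).ne]

end ChangeOfMeasure

lemma obsFiltration_eq_comap (n : ℕ) :
    obsFiltration n = MeasurableSpace.comap (Finset.range n).restrict MeasurableSpace.pi := by
  refine le_antisymm (iSup_le fun i => ?_) ?_
  · rintro _ ⟨s, hs, rfl⟩
    exact ⟨(fun y => y ⟨i, Finset.mem_range.2 i.2⟩) ⁻¹' s,
      (measurable_pi_apply _) hs, rfl⟩
  · refine Measurable.comap_le ?_
    rw [@measurable_pi_iff]
    exact fun i => measurable_eval_obsFiltration (Finset.mem_range.1 i.2)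

/-- Laws of infinite i.i.d. sequences need not be absolutely continuous even when their marginals
are. A function known at time `n` factors through the first `n` coordinates, where the finite
product argument applies. -/
lemma lintegral_iidLaw_mul_exp_neg_llr_le {Q P : ProbabilityMeasure ℝ} (h : (Q : Measure ℝ) ≪ P)
    {n : ℕ} {g : (ℕ → ℝ) → ℝ≥0∞} (hg : Measurable[obsFiltration n] g) :
    ∫⁻ x, g x * ∏ i ∈ Finset.range n,
      ENNReal.ofReal (Real.exp (-llr (Q : Measure ℝ) P (x i))) ∂(iidLaw Q) ≤
      ∫⁻ x, g x ∂(iidLaw P) := by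
  rw [obsFiltration_eq_comap] at hg
  obtain ⟨G, hG, rfl⟩ := hg.exists_eq_measurable_comp
  have hl := measurable_llr (Q : Measure ℝ) (P : Measure ℝ)
  have hQ := lintegral_restrict_infinitePi (fun _ : ℕ => (Q : Measure ℝ)) (s := Finset.range n)
    (f := fun y => G y * ∏ i, ENNReal.ofReal (Real.exp (-llr (Q : Measure ℝ) P (y i))))
    (by fun_prop)
  have hP := lintegral_restrict_infinitePi (fun _ : ℕ => (P : Measure ℝ)) (s := Finset.range n) hG
  refine le_trans (le_of_eq ?_) ((lintegral_pi_mul_exp_neg_llr_le h hG).trans hP.ge)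
  rw [← hQ]
  refine lintegral_congr fun x => ?_
  rw [Function.comp_apply, ← Finset.prod_coe_sort]
  rfl

/-- Under `P` the mean of `M n` is at most 1. Transferred to `P₁`, this says that M n·exp(-∑ llr)
has mean at most 1, and Jensen bounds the mean log by `n` times the divergence. -/
theorem IsTestSupermartingale.growthRateAt_le {S : Set (ProbabilityMeasure ℝ)}
    {M : ℕ → (ℕ → ℝ) → ℝ} (hM : IsTestSupermartingale S M) {P₁ P : ProbabilityMeasure ℝ}
    (hP : P ∈ S) (hac : (P₁ : Measure ℝ) ≪ P) (hint : Integrable (llr (P₁ : Measure ℝ) P) P₁) :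
    growthRateAt P₁ M ≤ ((∫ y, llr (P₁ : Measure ℝ) P y ∂(P₁ : Measure ℝ) : ℝ) : EReal) := by
  obtain ⟨h0, hM0, hsup⟩ := hM
  have hmart := hsup P hP
  have hmean : ∀ n, meanLog (iidLaw P₁) (M n) ≤
      ((n * ∫ y, llr (P₁ : Measure ℝ) P y ∂(P₁ : Measure ℝ) : ℝ) : EReal) := by
    intro n
    have hmeas : Measurable[obsFiltration n] (M n) := (hmart.stronglyAdapted n).measurable
    rw [← integral_sum_eval (measurable_llr _ _) hint]
    refine meanLog_le_integral (hmeas.mono (obsFiltration.le n) le_rfl) (h0 n)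
      (integrable_sum_eval hint n) ?_
    have hone : ∫⁻ x, ENNReal.ofReal (M n x) ∂(iidLaw P) ≤ 1 := by
      rw [← ofReal_integral_eq_lintegral_ofReal (hmart.integrable n) (ae_of_all _ (h0 n)),
        ENNReal.ofReal_le_one]
      have := hmart.setIntegral_le (Nat.zero_le n) MeasurableSet.univ
      simpa [hM0] using this
    refine le_trans (le_of_eq (lintegral_congr fun x => ?_))
      ((lintegral_iidLaw_mul_exp_neg_llr_le hac hmeas.ennreal_ofReal).trans hone)
    rw [← Finset.sum_neg_distrib, Real.exp_sum,
      ENNReal.ofReal_prod_of_nonneg fun i _ => (Real.exp_pos _).le]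
  refine limsup_le_of_le (by isBoundedDefault) ?_
  filter_upwards [eventually_gt_atTop 0] with n hn
  have hn' : (n : ℝ) ≠ 0 := by exact_mod_cast hn.ne'
  refine (EReal.div_le_div_right_of_nonneg (by exact_mod_cast Nat.zero_le n) (hmean n)).trans ?_
  rw [← EReal.coe_natCast, ← EReal.coe_div, mul_div_cancel_left₀ _ hn']

lemma growthRate_singleton (P : ProbabilityMeasure ℝ) (M : ℕ → (ℕ → ℝ) → ℝ) :
    growthRate {P} M = growthRateAt P M := by
  simp [growthRate]

lemma coe_minDiv {S : Set (ProbabilityMeasure ℝ)} {P₁ : ProbabilityMeasure ℝ}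
    (hfin : minDiv S P₁ < ∞) : (((minDiv S P₁).toReal : ℝ) : EReal) = (minDiv S P₁ : EReal) :=
  EReal.coe_ennreal_toReal hfin.ne

theorem IsNumeraireRatio.isGreatest_growthRate {S : Set (ProbabilityMeasure ℝ)}
    {P₁ : ProbabilityMeasure ℝ} {P₀ : Measure ℝ} {L : ℝ → ℝ≥0∞} (h : IsNumeraireRatio S P₁ P₀ L)
    (hconvex : IsConvexFamily S) (hfin : minDiv S P₁ < ∞) :
    IsGreatest {g : EReal | ∃ M : ℕ → (ℕ → ℝ) → ℝ, IsTestSupermartingale S M ∧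
      g = growthRate {P₁} M} (minDiv S P₁ : EReal) := by
  constructor
  -- The optimum is attained by betting the numeraire itself on every observation.
  · refine ⟨fun n x => ∏ i ∈ Finset.range n, (L (x i)).toReal,
      ⟨fun n x => Finset.prod_nonneg fun i _ => ENNReal.toReal_nonneg, fun x => by simp,
        fun P hP => ?_⟩, ?_⟩
    · exact supermartingale_prod_eval h.measurable_toReal (fun y => ENNReal.toReal_nonneg)
        ((lintegral_mono fun y => ENNReal.ofReal_toReal_le).trans (h.isNumeraire.1.2 P hP))
    · rw [growthRate_singleton, growthRateAt_prod_eval h.measurable_toReal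
        ((h.ae_pos_lt_top hfin).mono fun x hx => ENNReal.toReal_pos hx.1.ne' hx.2.ne)
        (h.integrable_log hconvex hfin), h.integral_log_eq hconvex hfin, coe_minDiv hfin]
  · rintro _ ⟨M, hM, rfl⟩
    rw [growthRate_singleton, ← coe_minDiv hfin]
    refine EReal.le_of_forall_lt_iff_le.1 fun z hz => ?_
    obtain ⟨P, hP, hac, hint, hlt⟩ := exists_integral_llr_lt hfin
      (sub_pos.2 (EReal.coe_lt_coe_iff.1 hz))
    refine (hM.growthRateAt_le hP hac hint).trans (EReal.coe_le_coe_iff.2 ?_)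
    linarith

/-! ### Total variation and contamination neighbourhoods -/

lemma abs_sub_le_tvDist (P Q : ProbabilityMeasure ℝ) {A : Set ℝ} (hA : MeasurableSet A) :
    |(P : Measure ℝ).real A - (Q : Measure ℝ).real A| ≤ tvDist P Q := by
  refine le_ciSup (f := fun A : {A : Set ℝ // MeasurableSet A} =>
    |(P : Measure ℝ).real A.1 - (Q : Measure ℝ).real A.1|) ⟨1, ?_⟩ ⟨A, hA⟩
  rintro _ ⟨B, rfl⟩
  have h1 : (P : Measure ℝ).real B.1 ≤ 1 := measureReal_le_one
  have h2 : (Q : Measure ℝ).real B.1 ≤ 1 := measureReal_le_one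
  have h3 : 0 ≤ (P : Measure ℝ).real B.1 := measureReal_nonneg
  have h4 : 0 ≤ (Q : Measure ℝ).real B.1 := measureReal_nonneg
  exact abs_le.2 ⟨by linarith, by linarith⟩

lemma integrable_of_mem_Icc {Ω : Type*} [MeasurableSpace Ω] {ν : Measure Ω} [IsFiniteMeasure ν]
    {f : Ω → ℝ} (hf : Measurable f) {a b : ℝ} (h : ∀ x, f x ∈ Icc a b) : Integrable f ν :=
  Integrable.of_mem_Icc a b hf.aemeasurable (ae_of_all _ h)

/-- Layer cake: the integral of f - a is the integral over t in [0, b - a] of the masses of its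
upper level sets, and each mass changes by at most the total variation distance. -/
lemma integral_sub_integral_le_tvDist (P Q : ProbabilityMeasure ℝ) {f : ℝ → ℝ}
    (hf : Measurable f) {a b : ℝ} (hab : a ≤ b) (h : ∀ x, f x ∈ Icc a b) :
    ∫ x, f x ∂(P : Measure ℝ) - ∫ x, f x ∂(Q : Measure ℝ) ≤ (b - a) * tvDist P Q := by
  have key : ∀ R : ProbabilityMeasure ℝ, ∫ x, f x ∂(R : Measure ℝ) =
      a + ∫ t in (0 : ℝ)..(b - a), (R : Measure ℝ).real {x | t ≤ f x - a} := by
    intro R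
    have hi : Integrable (fun x => f x - a) (R : Measure ℝ) :=
      (integrable_of_mem_Icc hf h).sub (integrable_const _)
    have := hi.integral_eq_integral_Ioc_meas_le (M := b - a)
      (ae_of_all _ fun x => sub_nonneg.2 (h x).1)
      (ae_of_all _ fun x => sub_le_sub_right (h x).2 a)
    rw [intervalIntegral.integral_of_le (sub_nonneg.2 hab), ← this,
      integral_sub (integrable_of_mem_Icc hf h) (integrable_const _)]
    simp
  have hanti : ∀ R : ProbabilityMeasure ℝ,
      Antitone fun t : ℝ => (R : Measure ℝ).real {x | t ≤ f x - a} := fun R s t hst =>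
    measureReal_mono fun x hx => le_trans hst hx
  rw [key P, key Q, add_sub_add_left_eq_sub, ← intervalIntegral.integral_sub
    (hanti P).intervalIntegrable (hanti Q).intervalIntegrable]
  have hle := intervalIntegral.integral_mono_on (a := 0) (b := b - a) (sub_nonneg.2 hab)
    ((hanti P).intervalIntegrable.sub (hanti Q).intervalIntegrable)
    (intervalIntegrable_const (c := tvDist P Q) (μ := volume)) fun t _ =>
    (le_abs_self _).trans
      (abs_sub_le_tvDist P Q (A := {x | t ≤ f x - a})
        (measurableSet_le measurable_const (hf.sub_const a)))
  refine hle.trans (le_of_eq ?_)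
  simp

lemma self_mem_tvNbhd (P : ProbabilityMeasure ℝ) {ε : ℝ} (hε : 0 ≤ ε) : P ∈ tvNbhd P ε := by
  simpa [tvNbhd, tvDist] using hε

lemma self_mem_contaminationNbhd (P : ProbabilityMeasure ℝ) {ε : ℝ} (hε : ε ∈ Ioo (0 : ℝ) 1) :
    P ∈ contaminationNbhd P ε := by
  refine ⟨P, ?_⟩
  rw [← add_smul, ← ENNReal.ofReal_add (by linarith [hε.2]) hε.1.le]
  simp

lemma contaminationNbhd_subset_tvNbhd (P : ProbabilityMeasure ℝ) {ε : ℝ}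
    (hε : ε ∈ Ioo (0 : ℝ) 1) : contaminationNbhd P ε ⊆ tvNbhd P ε := by
  rintro Q ⟨H, hQ⟩
  have : Nonempty {A : Set ℝ // MeasurableSet A} := ⟨⟨∅, MeasurableSet.empty⟩⟩
  show (⨆ A : {A : Set ℝ // MeasurableSet A}, _) ≤ ε
  refine ciSup_le (fun A : {A : Set ℝ // MeasurableSet A} => ?_)
  have h1 : (P : Measure ℝ).real A.1 ≤ 1 := measureReal_le_one
  have h2 : (H : Measure ℝ).real A.1 ≤ 1 := measureReal_le_one
  have h3 : 0 ≤ (P : Measure ℝ).real A.1 := measureReal_nonneg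
  have h4 : 0 ≤ (H : Measure ℝ).real A.1 := measureReal_nonneg
  have hreal : (Q : Measure ℝ).real A.1 =
      (1 - ε) * (P : Measure ℝ).real A.1 + ε * (H : Measure ℝ).real A.1 := by
    rw [hQ, measureReal_def, Measure.add_apply, Measure.smul_apply, Measure.smul_apply,
      smul_eq_mul, smul_eq_mul, ENNReal.toReal_add
        (ENNReal.mul_ne_top ENNReal.ofReal_ne_top (measure_ne_top _ _))
        (ENNReal.mul_ne_top ENNReal.ofReal_ne_top (measure_ne_top _ _)),
      ENNReal.toReal_mul, ENNReal.toReal_mul, ENNReal.toReal_ofReal (by linarith [hε.2]),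
      ENNReal.toReal_ofReal hε.1.le]
    rfl
  rw [hreal, show (P : Measure ℝ).real A.1 -
      ((1 - ε) * (P : Measure ℝ).real A.1 + ε * (H : Measure ℝ).real A.1) =
      ε * ((P : Measure ℝ).real A.1 - (H : Measure ℝ).real A.1) by ring, abs_mul,
    abs_of_pos hε.1]
  exact mul_le_of_le_one_right hε.1.le (abs_le.2 ⟨by linarith, by linarith⟩)

/-! ### The truncation levels -/

namespace IsNumeraireRatio

variable {S : Set (ProbabilityMeasure ℝ)} {P₁ : ProbabilityMeasure ℝ} {P₀ : Measure ℝ}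
  {L : ℝ → ℝ≥0∞}

lemma isFiniteMeasure (h : IsNumeraireRatio S P₁ P₀ L) : IsFiniteMeasure P₀ :=
  ⟨h.mass_le.trans_lt ENNReal.one_lt_top⟩

lemma real_univ_le_one (h : IsNumeraireRatio S P₁ P₀ L) : P₀.real univ ≤ 1 :=
  ENNReal.toReal_le_of_le_ofReal zero_le_one (by simpa using h.mass_le)

lemma lintegral_eq_one (h : IsNumeraireRatio S P₁ P₀ L) : ∫⁻ x, L x ∂P₀ = 1 := by
  rw [← setLIntegral_univ, ← withDensity_apply _ MeasurableSet.univ, ← h.eq_withDensity]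
  simp

lemma ae_lt_top (h : IsNumeraireRatio S P₁ P₀ L) : ∀ᵐ x ∂P₀, L x < ∞ :=
  MeasureTheory.ae_lt_top h.measurable (by rw [h.lintegral_eq_one]; exact ENNReal.one_ne_top)

lemma integrable_toReal (h : IsNumeraireRatio S P₁ P₀ L) :
    Integrable (fun x => (L x).toReal) P₀ :=
  integrable_toReal_of_lintegral_ne_top h.measurable.aemeasurable
    (by rw [h.lintegral_eq_one]; exact ENNReal.one_ne_top)

lemma setIntegral_toReal (h : IsNumeraireRatio S P₁ P₀ L) {A : Set ℝ} (hA : MeasurableSet A) :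
    ∫ x in A, (L x).toReal ∂P₀ = (P₁ : Measure ℝ).real A := by
  rw [integral_toReal h.measurable.aemeasurable (ae_restrict_of_ae h.ae_lt_top), measureReal_def,
    h.eq_withDensity, withDensity_apply _ hA]

lemma integral_toReal_eq_one (h : IsNumeraireRatio S P₁ P₀ L) :
    ∫ x, (L x).toReal ∂P₀ = 1 := by
  rw [← setIntegral_univ, h.setIntegral_toReal MeasurableSet.univ]
  simp

lemma ne_zero (h : IsNumeraireRatio S P₁ P₀ L) : P₀ ≠ 0 := by
  intro h0
  have := h.lintegral_eq_one
  simp [h0] at this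

lemma real_univ_pos (h : IsNumeraireRatio S P₁ P₀ L) : 0 < P₀.real univ := by
  have := h.isFiniteMeasure
  have : NeZero P₀ := ⟨h.ne_zero⟩
  exact measureReal_univ_pos

lemma integrable_max_toReal_sub (h : IsNumeraireRatio S P₁ P₀ L) (c : ℝ) :
    Integrable (fun x => max ((L x).toReal - c) 0) P₀ := by
  have := h.isFiniteMeasure
  exact (h.integrable_toReal.sub (integrable_const c)).pos_part

lemma integrable_max_sub_toReal (h : IsNumeraireRatio S P₁ P₀ L) (c : ℝ) :
    Integrable (fun x => max (c - (L x).toReal) 0) P₀ := by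
  have := h.isFiniteMeasure
  exact ((integrable_const c).sub h.integrable_toReal).pos_part

variable {ε lo hi : ℝ}

lemma _root_.RobustRIPr.IsHuberThresholds.lo_pos (hε : ε ∈ Ioo (0 : ℝ) 1)
    (T : IsHuberThresholds P₀ P₁ L ε lo hi) : 0 < lo := by
  refine T.lo_nonneg.lt_of_ne fun h0 => ?_
  have he := T.lo_eq
  rw [← h0, zero_mul, add_zero] at he
  have hle : (P₁ : Measure ℝ).real {x | ENNReal.ofReal 0 < L x} ≤ 1 := measureReal_le_one
  nlinarith [hε.1, hε.2]

lemma hi_pos (h : IsNumeraireRatio S P₁ P₀ L)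
    (T : IsHuberThresholds P₀ P₁ L ε lo hi) : 0 < hi := by
  refine T.hi_nonneg.lt_of_ne fun h0 => ?_
  -- With hi = 0 the convention 0⁻¹ = 0 makes the left side vanish, whereas `P₀` has positive mass.
  have he := T.hi_eq
  rw [← h0] at he
  simp only [ENNReal.ofReal_zero, not_lt_zero, ofPred_false, measureReal_empty, inv_zero,
    zero_mul, add_zero, mul_zero] at he
  exact h.real_univ_pos.ne he

/-- Huber's equation for `hi`, multiplied by `hi`, in terms of the excess of `L`. This form is
monotone in `hi`, which drives the asymptotics. -/
lemma integral_max_toReal_sub_hi (h : IsNumeraireRatio S P₁ P₀ L)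
    (T : IsHuberThresholds P₀ P₁ L ε lo hi) :
    (1 - ε) * ∫ x, max ((L x).toReal - hi) 0 ∂P₀ = hi * P₀.real univ * ε := by
  have := h.isFiniteMeasure
  have hhi := h.hi_pos T
  have hA : MeasurableSet {x | ENNReal.ofReal hi ≤ L x} :=
    measurableSet_le measurable_const h.measurable
  have hcompl : {x | L x < ENNReal.ofReal hi} = {x | ENNReal.ofReal hi ≤ L x}ᶜ := by
    ext x
    simp
  have hint : ∫ x, max ((L x).toReal - hi) 0 ∂P₀ =
      (P₁ : Measure ℝ).real {x | ENNReal.ofReal hi ≤ L x} -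
        hi * P₀.real {x | ENNReal.ofReal hi ≤ L x} := by
    rw [← h.setIntegral_toReal hA, show hi * P₀.real {x | ENNReal.ofReal hi ≤ L x} =
      ∫ _ in {x | ENNReal.ofReal hi ≤ L x}, hi ∂P₀ by simp [mul_comm],
      ← integral_sub h.integrable_toReal.integrableOn (integrable_const _),
      ← integral_indicator hA]
    refine integral_congr_ae ?_
    filter_upwards [h.ae_lt_top] with x hx
    by_cases hm : hi ≤ (L x).toReal
    · rw [indicator_of_mem (by exact (ENNReal.ofReal_le_iff_le_toReal hx.ne).2 hm),
        max_eq_left (by linarith)]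
    · rw [indicator_of_notMem (by exact fun hc => hm ((ENNReal.ofReal_le_iff_le_toReal hx.ne).1 hc)),
        max_eq_right (by linarith)]
  have he := T.hi_eq
  rw [hcompl, measureReal_compl hA] at he
  rw [hint]
  field_simp at he
  linarith

lemma integral_max_lo_sub_toReal (h : IsNumeraireRatio S P₁ P₀ L)
    (T : IsHuberThresholds P₀ P₁ L ε lo hi) :
    (1 - ε) * ∫ x, max (lo - (L x).toReal) 0 ∂P₀ = ε := by
  have := h.isFiniteMeasure
  have hA : MeasurableSet {x | L x ≤ ENNReal.ofReal lo} :=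
    measurableSet_le h.measurable measurable_const
  have hcompl : {x | ENNReal.ofReal lo < L x} = {x | L x ≤ ENNReal.ofReal lo}ᶜ := by
    ext x
    simp
  have hint : ∫ x, max (lo - (L x).toReal) 0 ∂P₀ =
      lo * P₀.real {x | L x ≤ ENNReal.ofReal lo} -
        (P₁ : Measure ℝ).real {x | L x ≤ ENNReal.ofReal lo} := by
    rw [← h.setIntegral_toReal hA, show lo * P₀.real {x | L x ≤ ENNReal.ofReal lo} =
      ∫ _ in {x | L x ≤ ENNReal.ofReal lo}, lo ∂P₀ by simp [mul_comm],
      ← integral_sub (integrable_const _) h.integrable_toReal.integrableOn,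
      ← integral_indicator hA]
    refine integral_congr_ae ?_
    filter_upwards [h.ae_lt_top] with x hx
    have hiff : L x ≤ ENNReal.ofReal lo ↔ (L x).toReal ≤ lo :=
      ENNReal.le_ofReal_iff_toReal_le hx.ne T.lo_nonneg
    by_cases hm : (L x).toReal ≤ lo
    · rw [indicator_of_mem (by exact hiff.2 hm), max_eq_left (by linarith)]
    · rw [indicator_of_notMem (by exact fun hc => hm (hiff.1 hc)), max_eq_right (by linarith)]
  have he := T.lo_eq
  rw [hcompl, probReal_compl_eq_one_sub hA] at he
  rw [hint]
  linarith

/-- Bounding the excess below by L - hi gives (1 - ε)(1 - hi·k) ≤ hi·k·ε, that is 1 - ε ≤ hi·k,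
where k ≤ 1 is the mass of `P₀`. -/
lemma one_sub_le_hi (h : IsNumeraireRatio S P₁ P₀ L) (hε : ε ∈ Ioo (0 : ℝ) 1)
    (T : IsHuberThresholds P₀ P₁ L ε lo hi) : 1 - ε ≤ hi := by
  have := h.isFiniteMeasure
  have hle : ∫ x, ((L x).toReal - hi) ∂P₀ ≤ ∫ x, max ((L x).toReal - hi) 0 ∂P₀ :=
    integral_mono (h.integrable_toReal.sub (integrable_const _)) (h.integrable_max_toReal_sub hi)
      fun x => le_max_left _ _
  rw [integral_sub h.integrable_toReal (integrable_const _), h.integral_toReal_eq_one,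
    integral_const, smul_eq_mul] at hle
  have he := h.integral_max_toReal_sub_hi T
  have hmul := mul_le_mul_of_nonneg_left hle (sub_nonneg.2 hε.2.le)
  rw [he] at hmul
  have hk : hi * P₀.real univ ≤ hi := mul_le_of_le_one_right T.hi_nonneg h.real_univ_le_one
  linarith

lemma le_lo (h : IsNumeraireRatio S P₁ P₀ L) (hε : 0 ≤ ε)
    (T : IsHuberThresholds P₀ P₁ L ε lo hi) : ε ≤ lo := by
  have := h.isFiniteMeasure
  have hle : ∫ x, max (lo - (L x).toReal) 0 ∂P₀ ≤ ∫ _, lo ∂P₀ :=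
    integral_mono (h.integrable_max_sub_toReal lo) (integrable_const _) fun x =>
      max_le (sub_le_self _ ENNReal.toReal_nonneg) T.lo_nonneg
  rw [integral_const, smul_eq_mul] at hle
  have hk : P₀.real univ * lo ≤ lo := mul_le_of_le_one_left T.lo_nonneg h.real_univ_le_one
  have he := h.integral_max_lo_sub_toReal T
  have h0 : 0 ≤ ∫ x, max (lo - (L x).toReal) 0 ∂P₀ := integral_nonneg fun x => le_max_right _ _
  have := mul_nonneg hε h0
  linarith

end IsNumeraireRatio

/-! ### The robust bet -/

section TruncatedRatio

variable {L : ℝ → ℝ≥0∞} {lo hi : ℝ}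

lemma measurable_truncatedRatio (hL : Measurable L) : Measurable (truncatedRatio L lo hi) := by
  unfold truncatedRatio
  fun_prop

/-- The upper end is `max lo hi` because lo ≤ hi is not assumed. -/
lemma truncatedRatio_mem_Icc (hhi : 0 ≤ hi) (x : ℝ) :
    truncatedRatio L lo hi x ∈ Icc lo (max lo hi) := by
  refine ⟨le_max_left _ _, max_le_max le_rfl ?_⟩
  exact ENNReal.toReal_le_of_le_ofReal hhi (min_le_left _ _)

lemma truncatedRatio_le {x : ℝ} (hx : L x ≠ ∞) :
    truncatedRatio L lo hi x ≤ (L x).toReal + max (lo - (L x).toReal) 0 := by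
  refine max_le ?_ ?_
  · have := le_max_left (lo - (L x).toReal) 0
    linarith
  · have h1 := ENNReal.toReal_mono hx (min_le_right (ENNReal.ofReal hi) (L x))
    have := le_max_right (lo - (L x).toReal) 0
    linarith

lemma min_le_truncatedRatio (hhi : 0 ≤ hi) {x : ℝ} (hx : L x ≠ ∞) :
    min hi (L x).toReal ≤ truncatedRatio L lo hi x := by
  refine le_trans (le_of_eq ?_) (le_max_right _ _)
  rw [ENNReal.toReal_min ENNReal.ofReal_ne_top hx, ENNReal.toReal_ofReal hhi]

lemma log_truncatedRatio_mem_Icc (hlo : 0 < lo) (hhi : 0 ≤ hi) (x : ℝ) :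
    Real.log (truncatedRatio L lo hi x) ∈ Icc (Real.log lo) (Real.log (max lo hi)) := by
  have h := truncatedRatio_mem_Icc (L := L) (lo := lo) hhi x
  exact ⟨Real.log_le_log hlo h.1, Real.log_le_log (hlo.trans_le h.1) h.2⟩

end TruncatedRatio

/-- The supremum over the null of the expected truncated ratio. -/
def supTruncated (S : Set (ProbabilityMeasure ℝ)) (L : ℝ → ℝ≥0∞) (lo hi : ℝ) : ℝ :=
  ⨆ P : S, ∫ y, truncatedRatio L lo hi y ∂(P.1 : Measure ℝ)

namespace IsNumeraireRatio

variable {S : Set (ProbabilityMeasure ℝ)} {P₁ : ProbabilityMeasure ℝ} {P₀ : Measure ℝ}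
  {L : ℝ → ℝ≥0∞} {ε lo hi : ℝ}

lemma integrable_truncatedRatio (h : IsNumeraireRatio S P₁ P₀ L) (hhi : 0 ≤ hi)
    (Q : ProbabilityMeasure ℝ) : Integrable (truncatedRatio L lo hi) Q :=
  integrable_of_mem_Icc (measurable_truncatedRatio h.measurable) (truncatedRatio_mem_Icc hhi)

lemma integrable_log_truncatedRatio (h : IsNumeraireRatio S P₁ P₀ L) (hlo : 0 < lo) (hhi : 0 ≤ hi)
    (Q : ProbabilityMeasure ℝ) : Integrable (fun x => Real.log (truncatedRatio L lo hi x)) Q :=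
  integrable_of_mem_Icc (measurable_truncatedRatio h.measurable).log
    (log_truncatedRatio_mem_Icc hlo hhi)

lemma integral_le_supTruncated (h : IsNumeraireRatio S P₁ P₀ L) (hhi : 0 ≤ hi)
    {P : ProbabilityMeasure ℝ} (hP : P ∈ S) :
    ∫ y, truncatedRatio L lo hi y ∂(P : Measure ℝ) ≤ supTruncated S L lo hi := by
  refine le_ciSup (f := fun P : S => ∫ y, truncatedRatio L lo hi y ∂(P.1 : Measure ℝ))
    ⟨max lo hi, ?_⟩ ⟨P, hP⟩
  rintro _ ⟨Q, rfl⟩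
  refine (integral_mono (h.integrable_truncatedRatio hhi Q.1) (integrable_const (max lo hi))
    fun x => (truncatedRatio_mem_Icc hhi x).2).trans ?_
  simp

lemma lo_le_supTruncated (h : IsNumeraireRatio S P₁ P₀ L) (hfin : minDiv S P₁ < ∞)
    (hhi : 0 ≤ hi) : lo ≤ supTruncated S L lo hi := by
  obtain ⟨P, hP, -⟩ := exists_mem_absolutelyContinuous hfin
  refine le_trans ?_ (h.integral_le_supTruncated hhi hP)
  have := integral_mono (integrable_const lo) (h.integrable_truncatedRatio (lo := lo) hhi P)
    fun x => (truncatedRatio_mem_Icc hhi x).1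
  simpa using this

/-- Since `lo` is at most the supremum, the possibly negative correction (hi - lo)·ε costs at most a
factor 1 - ε. This also keeps the denominator positive when hi < lo. -/
lemma mul_supTruncated_le (h : IsNumeraireRatio S P₁ P₀ L) (hfin : minDiv S P₁ < ∞)
    (hε : 0 ≤ ε) (hhi : 0 ≤ hi) :
    (1 - ε) * supTruncated S L lo hi ≤ supTruncated S L lo hi + (hi - lo) * ε := by
  have := h.lo_le_supTruncated hfin (lo := lo) hhi
  nlinarith [mul_nonneg hhi hε]

lemma denominator_pos (h : IsNumeraireRatio S P₁ P₀ L) (hfin : minDiv S P₁ < ∞)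
    (hε : ε ∈ Ioo (0 : ℝ) 1) (hlo : 0 < lo) (hhi : 0 ≤ hi) :
    0 < supTruncated S L lo hi + (hi - lo) * ε :=
  (mul_pos (sub_pos.2 hε.2) (hlo.trans_le (h.lo_le_supTruncated hfin hhi))).trans_le
    (h.mul_supTruncated_le hfin hε.1.le hhi)

lemma log_robustBet (h : IsNumeraireRatio S P₁ P₀ L) (hfin : minDiv S P₁ < ∞)
    (hε : ε ∈ Ioo (0 : ℝ) 1) (hlo : 0 < lo) (hhi : 0 ≤ hi) (x : ℝ) :
    Real.log (robustBet S L ε lo hi x) = Real.log (truncatedRatio L lo hi x) -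
      Real.log (supTruncated S L lo hi + (hi - lo) * ε) :=
  Real.log_div (hlo.trans_le (truncatedRatio_mem_Icc hhi x).1).ne'
    (h.denominator_pos hfin hε hlo hhi).ne'

lemma robustBet_pos (h : IsNumeraireRatio S P₁ P₀ L) (hfin : minDiv S P₁ < ∞)
    (hε : ε ∈ Ioo (0 : ℝ) 1) (hlo : 0 < lo) (hhi : 0 ≤ hi) (x : ℝ) :
    0 < robustBet S L ε lo hi x :=
  div_pos (hlo.trans_le (truncatedRatio_mem_Icc hhi x).1) (h.denominator_pos hfin hε hlo hhi)

lemma measurable_robustBet (h : IsNumeraireRatio S P₁ P₀ L) :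
    Measurable (robustBet S L ε lo hi) :=
  (measurable_truncatedRatio h.measurable).div_const _

lemma integrable_log_robustBet (h : IsNumeraireRatio S P₁ P₀ L) (hfin : minDiv S P₁ < ∞)
    (hε : ε ∈ Ioo (0 : ℝ) 1) (hlo : 0 < lo) (hhi : 0 ≤ hi) (Q : ProbabilityMeasure ℝ) :
    Integrable (fun x => Real.log (robustBet S L ε lo hi x)) Q := by
  simp only [h.log_robustBet hfin hε hlo hhi]
  exact (h.integrable_log_truncatedRatio hlo hhi Q).sub (integrable_const _)

lemma integral_log_robustBet (h : IsNumeraireRatio S P₁ P₀ L) (hfin : minDiv S P₁ < ∞)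
    (hε : ε ∈ Ioo (0 : ℝ) 1) (hlo : 0 < lo) (hhi : 0 ≤ hi) (Q : ProbabilityMeasure ℝ) :
    ∫ x, Real.log (robustBet S L ε lo hi x) ∂(Q : Measure ℝ) =
      ∫ x, Real.log (truncatedRatio L lo hi x) ∂(Q : Measure ℝ) -
        Real.log (supTruncated S L lo hi + (hi - lo) * ε) := by
  simp only [h.log_robustBet hfin hε hlo hhi]
  rw [integral_sub (h.integrable_log_truncatedRatio hlo hhi Q) (integrable_const _)]
  simp

lemma growthRateAt_robust (h : IsNumeraireRatio S P₁ P₀ L) (hfin : minDiv S P₁ < ∞)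
    (hε : ε ∈ Ioo (0 : ℝ) 1) (hlo : 0 < lo) (hhi : 0 ≤ hi) (Q : ProbabilityMeasure ℝ) :
    growthRateAt Q (robustProcess S L ε lo hi) =
      ((∫ x, Real.log (robustBet S L ε lo hi x) ∂(Q : Measure ℝ) : ℝ) : EReal) :=
  growthRateAt_prod_eval h.measurable_robustBet
    (ae_of_all _ (h.robustBet_pos hfin hε hlo hhi))
    (h.integrable_log_robustBet hfin hε hlo hhi Q)

/-- The truncated ratio divided by its supremum over the null is an e-variable, so its mean log is
at most the divergence from any null member. -/
lemma integral_log_truncatedRatio_le (h : IsNumeraireRatio S P₁ P₀ L) (hfin : minDiv S P₁ < ∞)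
    (hlo : 0 < lo) (hhi : 0 ≤ hi) :
    ∫ x, Real.log (truncatedRatio L lo hi x) ∂(P₁ : Measure ℝ) ≤
      (minDiv S P₁).toReal + Real.log (supTruncated S L lo hi) := by
  refine le_of_forall_pos_le_add fun δ hδ => ?_
  obtain ⟨P, hP, hac, hint, hlt⟩ := exists_integral_llr_lt hfin hδ
  have hs : 0 < supTruncated S L lo hi := hlo.trans_le (h.lo_le_supTruncated hfin hhi)
  have hlog := h.integrable_log_truncatedRatio hlo hhi P₁
  have hint' : Integrable (fun x => llr (P₁ : Measure ℝ) P x +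
      Real.log (supTruncated S L lo hi)) P₁ := hint.add (integrable_const _)
  have hle := integral_le_integral_of_lintegral_exp_sub_le hlog hint' ?_
  · rw [integral_add hint (integrable_const _)] at hle
    simp only [integral_const, probReal_univ, smul_eq_mul, one_mul] at hle
    linarith
  have hm := measurable_truncatedRatio (lo := lo) (hi := hi) h.measurable
  have hpos : ∀ x, 0 < truncatedRatio L lo hi x := fun x =>
    hlo.trans_le (truncatedRatio_mem_Icc hhi x).1
  calc ∫⁻ x, ENNReal.ofReal (Real.exp (Real.log (truncatedRatio L lo hi x) -
        (llr (P₁ : Measure ℝ) P x + Real.log (supTruncated S L lo hi)))) ∂(P₁ : Measure ℝ)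
      = ∫⁻ x, ENNReal.ofReal (truncatedRatio L lo hi x / supTruncated S L lo hi) *
          ENNReal.ofReal (Real.exp (-llr (P₁ : Measure ℝ) P x)) ∂(P₁ : Measure ℝ) := by
        refine lintegral_congr fun x => ?_
        rw [← ENNReal.ofReal_mul (div_pos (hpos x) hs).le, add_comm, ← sub_sub, sub_eq_add_neg,
          Real.exp_add, Real.exp_sub, Real.exp_log (hpos x), Real.exp_log hs]
    _ ≤ ∫⁻ x, ENNReal.ofReal (truncatedRatio L lo hi x / supTruncated S L lo hi)
          ∂(P : Measure ℝ) := lintegral_mul_exp_neg_llr_le hac (hm.div_const _).ennreal_ofReal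
    _ ≤ 1 := by
        rw [← ofReal_integral_eq_lintegral_ofReal
          ((h.integrable_truncatedRatio hhi P).div_const _)
          (ae_of_all _ fun x => (div_pos (hpos x) hs).le), ENNReal.ofReal_le_one, integral_div,
          div_le_one hs]
        exact h.integral_le_supTruncated hhi hP

end IsNumeraireRatio

/-! ### The limit of vanishing contamination -/

lemma tendsto_integral_zero_of_dominated {Ω : Type*} [MeasurableSpace Ω] {ν : Measure Ω}
    {F : ℕ → Ω → ℝ} {g : Ω → ℝ} (hF : ∀ n, AEStronglyMeasurable (F n) ν) (hg : Integrable g ν)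
    (hle : ∀ n x, |F n x| ≤ g x) (hev : ∀ x, ∀ᶠ n in atTop, F n x = 0) :
    Tendsto (fun n => ∫ x, F n x ∂ν) atTop (𝓝 0) := by
  rw [← integral_zero Ω ℝ (μ := ν)]
  exact tendsto_integral_of_dominated_convergence g hF hg (fun n => ae_of_all _ (hle n))
    (ae_of_all _ fun x => (tendsto_const_nhds (x := (0 : ℝ))).congr' (by
      filter_upwards [hev x] with n hn using hn.symm))

lemma Ioo_mem_nhdsGT_zero : Ioo (0 : ℝ) 1 ∈ 𝓝[>] (0 : ℝ) := Ioo_mem_nhdsGT one_pos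

lemma eventually_mul_lt (c : ℝ) {η : ℝ} (hη : 0 < η) : ∀ᶠ ε in 𝓝[>] (0 : ℝ), ε * c < η := by
  have : Tendsto (fun ε : ℝ => ε * c) (𝓝[>] 0) (𝓝 0) := by
    have h : Tendsto (fun ε : ℝ => ε * c) (𝓝 0) (𝓝 (0 * c)) := tendsto_id.mul_const c
    rw [zero_mul] at h
    exact h.mono_left nhdsWithin_le_nhds
  exact this.eventually (gt_mem_nhds hη)

namespace IsNumeraireRatio

variable {S : Set (ProbabilityMeasure ℝ)} {P₁ : ProbabilityMeasure ℝ} {P₀ : Measure ℝ}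
  {L : ℝ → ℝ≥0∞} {lo hi : ℝ → ℝ}

/-- Fix `K` with a small tail ∫ (L - K)₊ dP₀. If hi ≤ K, a small ε suffices; if hi > K, Huber's
equation bounds hi·k·ε by that tail. No regularity of `hi` in ε is needed. -/
lemma eventually_mul_hi_lt (h : IsNumeraireRatio S P₁ P₀ L)
    (T : ∀ ε ∈ Ioo (0 : ℝ) 1, IsHuberThresholds P₀ P₁ L ε (lo ε) (hi ε)) {η : ℝ} (hη : 0 < η) :
    ∀ᶠ ε in 𝓝[>] (0 : ℝ), ε * hi ε < η := by
  have := h.isFiniteMeasure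
  have hk := h.real_univ_pos
  have htail : Tendsto (fun K : ℕ => ∫ x, max ((L x).toReal - K) 0 ∂P₀) atTop (𝓝 0) := by
    refine tendsto_integral_zero_of_dominated
      (fun K => (h.integrable_max_toReal_sub K).aestronglyMeasurable) h.integrable_toReal
      (fun K x => ?_) (fun x => ?_)
    · rw [abs_of_nonneg (le_max_right _ _)]
      exact max_le (sub_le_self _ (Nat.cast_nonneg K)) ENNReal.toReal_nonneg
    · filter_upwards [eventually_ge_atTop ⌈(L x).toReal⌉₊] with n hn
      exact max_eq_right (sub_nonpos.2 (Nat.ceil_le.1 hn))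
  obtain ⟨K, hK⟩ := (htail.eventually (gt_mem_nhds (mul_pos hη hk))).exists
  filter_upwards [Ioo_mem_nhdsGT_zero, eventually_mul_lt K hη] with ε hε hεK
  rcases le_or_gt (hi ε) K with hle | hgt
  · exact (mul_le_mul_of_nonneg_left hle hε.1.le).trans_lt hεK
  · have he := h.integral_max_toReal_sub_hi (T ε hε)
    have hmono : ∫ x, max ((L x).toReal - hi ε) 0 ∂P₀ ≤ ∫ x, max ((L x).toReal - K) 0 ∂P₀ :=
      integral_mono (h.integrable_max_toReal_sub _) (h.integrable_max_toReal_sub _) fun x =>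
        max_le_max (sub_le_sub_left hgt.le _) le_rfl
    have h0 : 0 ≤ ∫ x, max ((L x).toReal - hi ε) 0 ∂P₀ := integral_nonneg fun x => le_max_right _ _
    have h1 : hi ε * P₀.real univ * ε < η * P₀.real univ := by
      have := mul_nonneg hε.1.le h0
      linarith
    refine lt_of_mul_lt_mul_right (a := P₀.real univ) ?_ hk.le
    linarith

/-- Here log hi ≤ hi and lo ≥ ε, so the product is at most ε·hi - ε·log ε. -/
lemma eventually_mul_log_sub_log_lt (h : IsNumeraireRatio S P₁ P₀ L)
    (T : ∀ ε ∈ Ioo (0 : ℝ) 1, IsHuberThresholds P₀ P₁ L ε (lo ε) (hi ε)) {η : ℝ} (hη : 0 < η) :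
    ∀ᶠ ε in 𝓝[>] (0 : ℝ), ε * (Real.log (max (lo ε) (hi ε)) - Real.log (lo ε)) < η := by
  have hlog : ∀ᶠ ε in 𝓝[>] (0 : ℝ), -(ε * Real.log ε) < η / 2 := by
    have ht := (Real.continuous_mul_log.tendsto 0).neg
    rw [zero_mul, neg_zero] at ht
    exact (ht.mono_left nhdsWithin_le_nhds).eventually (gt_mem_nhds (half_pos hη))
  filter_upwards [Ioo_mem_nhdsGT_zero, hlog, h.eventually_mul_hi_lt T (half_pos hη)]
    with ε hε h1 h2
  have hlo := (T ε hε).lo_pos hε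
  rcases le_total (hi ε) (lo ε) with hle | hle
  · rw [max_eq_left hle, sub_self, mul_zero]
    exact hη
  · rw [max_eq_right hle]
    have h3 : Real.log (hi ε) ≤ hi ε := Real.log_le_self (hlo.le.trans hle)
    have h4 : Real.log ε ≤ Real.log (lo ε) := Real.log_le_log hε.1 (h.le_lo hε.1.le (T ε hε))
    have h5 : ε * (Real.log (hi ε) - Real.log (lo ε)) ≤ ε * (hi ε - Real.log ε) :=
      mul_le_mul_of_nonneg_left (by linarith) hε.1.le
    linarith

/-- An approximate essential infimum of `L`: otherwise an almost sure lower bound could be raised by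
`δ` indefinitely, starting from 0. -/
lemma exists_ae_le_not_ae_le (h : IsNumeraireRatio S P₁ P₀ L) {δ : ℝ} (hδ : 0 < δ) :
    ∃ c : ℝ, (∀ᵐ x ∂P₀, c ≤ (L x).toReal) ∧ ¬ ∀ᵐ x ∂P₀, c + δ ≤ (L x).toReal := by
  by_contra! hcon
  have hall : ∀ n : ℕ, ∀ᵐ x ∂P₀, n * δ ≤ (L x).toReal := by
    intro n
    induction n with
    | zero => exact ae_of_all _ fun x => by simp
    | succ n ih =>
      have := hcon _ ih
      push_cast
      rwa [add_mul, one_mul]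
  have : NeZero P₀ := ⟨h.ne_zero⟩
  obtain ⟨x, hx⟩ := (ae_all_iff.2 hall).exists
  obtain ⟨n, hn⟩ := exists_nat_gt ((L x).toReal / δ)
  rw [div_lt_iff₀ hδ] at hn
  exact absurd (hx n) (not_le.2 hn)

/-- The level `lo` cannot stay above c + δ: ∫ (lo - L)₊ dP₀ would then be bounded below, while
Huber's equation sends it to 0. Since L ≥ c a.e. under every null member, raising `L` to `lo` adds
at most `δ` to its expectation. -/
lemma eventually_supTruncated_le (h : IsNumeraireRatio S P₁ P₀ L) (hfin : minDiv S P₁ < ∞)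
    (T : ∀ ε ∈ Ioo (0 : ℝ) 1, IsHuberThresholds P₀ P₁ L ε (lo ε) (hi ε)) {δ : ℝ} (hδ : 0 < δ) :
    ∀ᶠ ε in 𝓝[>] (0 : ℝ), supTruncated S L (lo ε) (hi ε) ≤ 1 + δ := by
  obtain ⟨c, hc, hnc⟩ := h.exists_ae_le_not_ae_le hδ
  have hθ : 0 < ∫ x, max (c + δ - (L x).toReal) 0 ∂P₀ := by
    refine (integral_nonneg fun x => le_max_right _ _).lt_of_ne fun h0 => hnc ?_
    have := (integral_eq_zero_iff_of_nonneg (fun x => le_max_right _ _)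
      (h.integrable_max_sub_toReal (c + δ))).1 h0.symm
    filter_upwards [this] with x hx
    have hle := le_max_left (c + δ - (L x).toReal) 0
    rw [show max (c + δ - (L x).toReal) 0 = 0 from hx] at hle
    linarith
  filter_upwards [Ioo_mem_nhdsGT_zero, eventually_mul_lt
    (1 + ∫ x, max (c + δ - (L x).toReal) 0 ∂P₀) hθ] with ε hε hlt
  have hT := T ε hε
  have hlo : lo ε ≤ c + δ := by
    by_contra! hgt
    have hmono : ∫ x, max (c + δ - (L x).toReal) 0 ∂P₀ ≤ ∫ x, max (lo ε - (L x).toReal) 0 ∂P₀ :=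
      integral_mono (h.integrable_max_sub_toReal _) (h.integrable_max_sub_toReal _) fun x =>
        max_le_max (sub_le_sub_right hgt.le _) le_rfl
    have he := h.integral_max_lo_sub_toReal hT
    have := mul_le_mul_of_nonneg_left hmono (sub_nonneg.2 hε.2.le)
    linarith
  obtain ⟨P', hP', -⟩ := exists_mem_absolutelyContinuous hfin
  have : Nonempty S := ⟨⟨P', hP'⟩⟩
  refine ciSup_le fun P => ?_
  have hL1 := h.isNumeraire.1.2 P.1 P.2
  have hfinite : ∀ᵐ x ∂(P.1 : Measure ℝ), L x < ∞ := h.isNumeraire.1.ae_lt_top P.2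
  have hint : Integrable (fun x => (L x).toReal) (P.1 : Measure ℝ) :=
    integrable_toReal_of_lintegral_ne_top h.measurable.aemeasurable
      (hL1.trans_lt ENNReal.one_lt_top).ne
  have hle : ∫ x, (L x).toReal ∂(P.1 : Measure ℝ) ≤ 1 := by
    rw [integral_toReal h.measurable.aemeasurable hfinite]
    exact ENNReal.toReal_le_of_le_ofReal zero_le_one (by simpa using hL1)
  calc ∫ y, truncatedRatio L (lo ε) (hi ε) y ∂(P.1 : Measure ℝ)
      ≤ ∫ x, ((L x).toReal + δ) ∂(P.1 : Measure ℝ) := by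
        refine integral_mono_ae (h.integrable_truncatedRatio hT.hi_nonneg P.1)
          (hint.add (integrable_const _)) ?_
        filter_upwards [hfinite, (h.ac P.1 P.2).ae_le hc] with x hx hcx
        refine (truncatedRatio_le hx.ne).trans (add_le_add_right (max_le ?_ hδ.le) _)
        linarith
    _ ≤ 1 + δ := by
        rw [integral_add hint (integrable_const _)]
        simpa using hle

lemma integral_log_truncatedRatio_ge (h : IsNumeraireRatio S P₁ P₀ L) (hconvex : IsConvexFamily S)
    (hfin : minDiv S P₁ < ∞) {ε a b : ℝ} (hε : ε ∈ Ioo (0 : ℝ) 1) (hε2 : ε ≤ 1 / 2)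
    (T : IsHuberThresholds P₀ P₁ L ε a b) {K : ℝ} (hK : 0 ≤ K) :
    (minDiv S P₁).toReal - ε * (2 * K) -
      ∫ x, {x | K < (L x).toReal}.indicator
        (fun x => |Real.log (L x).toReal| + Real.log 2) x ∂(P₁ : Measure ℝ) ≤
      ∫ x, Real.log (truncatedRatio L a b x) ∂(P₁ : Measure ℝ) := by
  have := h.isFiniteMeasure
  have ha := T.lo_pos hε
  have hb := h.hi_pos T
  have hlog := h.integrable_log hconvex hfin
  have hlm := h.measurable_toReal
  have hsm : MeasurableSet {x | K < (L x).toReal} := measurableSet_lt measurable_const hlm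
  -- For hi < L ≤ K the loss log(L / hi) is at most (L - hi)/hi. Its `P₁`-mean becomes a
  -- `P₀`-integral with weight L ≤ K, where Huber's equation applies. For L > K the loss is at most
  -- |log L| + log 2, because hi ≥ 1 - ε ≥ 1/2.
  set g : ℝ → ℝ := {x | K < (L x).toReal}ᶜ.indicator fun x => max ((L x).toReal - b) 0 / b
  have hgm : Measurable g := Measurable.indicator (by fun_prop) hsm.compl
  have hg0 : ∀ x, 0 ≤ g x := fun x =>
    indicator_nonneg (fun x _ => div_nonneg (le_max_right _ _) hb.le) x
  have hgK : ∀ x, g x ≤ K / b := by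
    intro x
    refine indicator_apply_le' (fun hx => ?_) (fun _ => div_nonneg hK hb.le)
    have hx' : (L x).toReal ≤ K := not_lt.1 hx
    gcongr
    exact max_le (by linarith) hK
  have hgi : Integrable g P₁ := integrable_of_mem_Icc hgm fun x => ⟨hg0 x, hgK x⟩
  have hti : Integrable ({x | K < (L x).toReal}.indicator
      fun x => |Real.log (L x).toReal| + Real.log 2) P₁ :=
    (hlog.abs.add (integrable_const _)).indicator hsm
  have hgle : ∫ x, g x ∂(P₁ : Measure ℝ) ≤ ε * (2 * K) := by
    have hchange : ∫ x, g x ∂(P₁ : Measure ℝ) = ∫ x, (L x).toReal • g x ∂P₀ := by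
      rw [h.eq_withDensity, integral_withDensity_eq_integral_toReal_smul h.measurable h.ae_lt_top]
    have hmono : ∫ x, (L x).toReal • g x ∂P₀ ≤ ∫ x, K / b * max ((L x).toReal - b) 0 ∂P₀ := by
      refine integral_mono_of_nonneg (ae_of_all _ fun x => ?_)
        ((h.integrable_max_toReal_sub b).const_mul _) (ae_of_all _ fun x => ?_)
      · exact mul_nonneg ENNReal.toReal_nonneg (hg0 x)
      · simp only [smul_eq_mul]
        have hm : 0 ≤ max ((L x).toReal - b) 0 := le_max_right _ _
        by_cases hx : K < (L x).toReal
        · rw [show g x = 0 from indicator_of_notMem (by exact fun hc => hc hx) _, mul_zero]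
          positivity
        · rw [show g x = max ((L x).toReal - b) 0 / b from indicator_of_mem (by exact hx) _]
          have hle : (L x).toReal ≤ K := not_lt.1 hx
          calc (L x).toReal * (max ((L x).toReal - b) 0 / b)
              ≤ K * (max ((L x).toReal - b) 0 / b) := by gcongr
            _ = _ := by ring
    rw [integral_const_mul] at hmono
    have hnn : 0 ≤ ∫ x, max ((L x).toReal - b) 0 ∂P₀ := integral_nonneg fun x => le_max_right _ _
    have hint : ∫ x, max ((L x).toReal - b) 0 ∂P₀ ≤ 2 * ε * b := by
      have he := h.integral_max_toReal_sub_hi T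
      have hk : b * P₀.real univ * ε ≤ b * 1 * ε := by
        gcongr
        · exact hε.1.le
        · exact h.real_univ_le_one
      have := mul_le_mul_of_nonneg_right (show 1 / 2 ≤ 1 - ε by linarith) hnn
      linarith
    calc ∫ x, g x ∂(P₁ : Measure ℝ) ≤ K / b * ∫ x, max ((L x).toReal - b) 0 ∂P₀ :=
          hchange.trans_le hmono
      _ ≤ K / b * (2 * ε * b) := by gcongr
      _ = ε * (2 * K) := by field_simp
  have hmain : ∫ x, Real.log (L x).toReal ∂(P₁ : Measure ℝ) ≤
      ∫ x, (Real.log (truncatedRatio L a b x) + g x + {x | K < (L x).toReal}.indicator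
        (fun x => |Real.log (L x).toReal| + Real.log 2) x) ∂(P₁ : Measure ℝ) := by
    refine integral_mono_ae hlog
      (((h.integrable_log_truncatedRatio ha hb.le P₁).add hgi).add hti) ?_
    filter_upwards [h.ae_pos_lt_top hfin] with x hx
    have hpos : 0 < (L x).toReal := ENNReal.toReal_pos hx.1.ne' hx.2.ne
    have hmin : Real.log (min b (L x).toReal) ≤ Real.log (truncatedRatio L a b x) :=
      Real.log_le_log (lt_min hb hpos) (min_le_truncatedRatio hb.le hx.2.ne)
    have htn : 0 ≤ {x | K < (L x).toReal}.indicator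
        (fun x => |Real.log (L x).toReal| + Real.log 2) x :=
      indicator_nonneg (fun x _ => add_nonneg (abs_nonneg _) (Real.log_nonneg (by norm_num))) x
    have hgx := hg0 x
    rcases le_or_gt (L x).toReal b with hle | hgt
    · rw [min_eq_right hle] at hmin
      linarith
    rw [min_eq_left hgt.le] at hmin
    by_cases hKx : K < (L x).toReal
    · rw [indicator_of_mem (by exact hKx)]
      have h1 : Real.log (1 / 2) ≤ Real.log b :=
        Real.log_le_log (by norm_num) (by linarith [h.one_sub_le_hi hε T])
      rw [one_div, Real.log_inv] at h1
      have h2 := le_abs_self (Real.log (L x).toReal)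
      linarith
    · rw [show g x = max ((L x).toReal - b) 0 / b from indicator_of_mem (by exact hKx) _,
        max_eq_left (by linarith)]
      have h1 := Real.log_le_sub_one_of_pos (div_pos hpos hb)
      rw [Real.log_div hpos.ne' hb.ne'] at h1
      have h2 : ((L x).toReal - b) / b = (L x).toReal / b - 1 := by field_simp
      linarith
  have hsum : Integrable (fun x => Real.log (truncatedRatio L a b x) + g x) P₁ :=
    (h.integrable_log_truncatedRatio ha hb.le P₁).add hgi
  rw [integral_add hsum hti, integral_add (h.integrable_log_truncatedRatio ha hb.le P₁) hgi,
    h.integral_log_eq hconvex hfin] at hmain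
  linarith

lemma eventually_integral_log_truncatedRatio_ge (h : IsNumeraireRatio S P₁ P₀ L)
    (hconvex : IsConvexFamily S) (hfin : minDiv S P₁ < ∞)
    (T : ∀ ε ∈ Ioo (0 : ℝ) 1, IsHuberThresholds P₀ P₁ L ε (lo ε) (hi ε)) {η : ℝ} (hη : 0 < η) :
    ∀ᶠ ε in 𝓝[>] (0 : ℝ), (minDiv S P₁).toReal - η ≤
      ∫ x, Real.log (truncatedRatio L (lo ε) (hi ε) x) ∂(P₁ : Measure ℝ) := by
  have hlog := h.integrable_log hconvex hfin
  have hsm : ∀ K : ℕ, MeasurableSet {x | (K : ℝ) < (L x).toReal} := fun K =>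
    measurableSet_lt measurable_const h.measurable_toReal
  have hbi : Integrable (fun x => |Real.log (L x).toReal| + Real.log 2) P₁ :=
    hlog.abs.add (integrable_const _)
  have hb0 : ∀ x, 0 ≤ |Real.log (L x).toReal| + Real.log 2 := fun x =>
    add_nonneg (abs_nonneg _) (Real.log_nonneg (by norm_num))
  have htail : Tendsto (fun K : ℕ => ∫ x, {x | (K : ℝ) < (L x).toReal}.indicator
      (fun x => |Real.log (L x).toReal| + Real.log 2) x ∂(P₁ : Measure ℝ)) atTop (𝓝 0) := by
    refine tendsto_integral_zero_of_dominated
      (fun K => (hbi.indicator (hsm K)).aestronglyMeasurable) hbi (fun K x => ?_) (fun x => ?_)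
    · rw [abs_of_nonneg (indicator_nonneg (fun x _ => hb0 x) x)]
      exact indicator_le_self' (fun x _ => hb0 x) x
    · filter_upwards [eventually_ge_atTop ⌈(L x).toReal⌉₊] with n hn
      exact indicator_of_notMem (by exact not_lt.2 (Nat.ceil_le.1 hn)) _
  obtain ⟨K, hK⟩ := (htail.eventually (gt_mem_nhds (half_pos hη))).exists
  filter_upwards [Ioo_mem_nhdsGT_zero, Ioo_mem_nhdsGT (show (0 : ℝ) < 1 / 2 by norm_num),
    eventually_mul_lt (2 * K) (half_pos hη)] with ε hε hε2 hlt
  have := h.integral_log_truncatedRatio_ge hconvex hfin hε hε2.2.le (T ε hε)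
    (Nat.cast_nonneg (α := ℝ) K)
  linarith

lemma eventually_le_growthRate (h : IsNumeraireRatio S P₁ P₀ L)
    (hconvex : IsConvexFamily S) (hfin : minDiv S P₁ < ∞)
    (T : ∀ ε ∈ Ioo (0 : ℝ) 1, IsHuberThresholds P₀ P₁ L ε (lo ε) (hi ε))
    {H : ℝ → Set (ProbabilityMeasure ℝ)} (hH : ∀ ε ∈ Ioo (0 : ℝ) 1, H ε ⊆ tvNbhd P₁ ε)
    {η : ℝ} (hη : 0 < η) :
    ∀ᶠ ε in 𝓝[>] (0 : ℝ), (((minDiv S P₁).toReal - η : ℝ) : EReal) ≤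
      growthRate (H ε) (robustProcess S L ε (lo ε) (hi ε)) := by
  -- One quarter each for lower truncation loss at `P₁`, the move from `P₁` to `Q`, the excess of
  -- the supremum over 1, and hi·ε in the denominator.
  have hη4 : 0 < η / 4 := by positivity
  filter_upwards [Ioo_mem_nhdsGT_zero, h.eventually_mul_hi_lt T hη4,
    h.eventually_mul_log_sub_log_lt T hη4, h.eventually_supTruncated_le hfin T hη4,
    h.eventually_integral_log_truncatedRatio_ge hconvex hfin T hη4] with ε hε h1 h2 h3 h4
  have hT := T ε hε
  have hlo := hT.lo_pos hε
  refine le_iInf₂ fun Q hQ => ?_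
  rw [h.growthRateAt_robust hfin hε hlo hT.hi_nonneg, EReal.coe_le_coe_iff,
    h.integral_log_robustBet hfin hε hlo hT.hi_nonneg]
  have htv : tvDist P₁ Q ≤ ε := hH ε hε hQ
  have hab : Real.log (lo ε) ≤ Real.log (max (lo ε) (hi ε)) :=
    Real.log_le_log hlo (le_max_left _ _)
  have hdiff := integral_sub_integral_le_tvDist P₁ Q
    (measurable_truncatedRatio (lo := lo ε) (hi := hi ε) h.measurable).log hab
    (log_truncatedRatio_mem_Icc hlo hT.hi_nonneg)
  have hmul := mul_le_mul_of_nonneg_left htv (sub_nonneg.2 hab)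
  have hden := Real.log_le_sub_one_of_pos (h.denominator_pos hfin hε hlo hT.hi_nonneg)
  have := mul_pos hlo hε.1
  linarith

/-- At Q = P₁ the logarithm of the supremum cancels, leaving D - log(1 - ε). -/
lemma eventually_growthRate_le (h : IsNumeraireRatio S P₁ P₀ L) (hfin : minDiv S P₁ < ∞)
    (T : ∀ ε ∈ Ioo (0 : ℝ) 1, IsHuberThresholds P₀ P₁ L ε (lo ε) (hi ε))
    {H : ℝ → Set (ProbabilityMeasure ℝ)} (hH : ∀ ε ∈ Ioo (0 : ℝ) 1, P₁ ∈ H ε)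
    {η : ℝ} (hη : 0 < η) :
    ∀ᶠ ε in 𝓝[>] (0 : ℝ), growthRate (H ε) (robustProcess S L ε (lo ε) (hi ε)) ≤
      (((minDiv S P₁).toReal + η : ℝ) : EReal) := by
  have hlog : ∀ᶠ ε in 𝓝[>] (0 : ℝ), -Real.log (1 - ε) < η := by
    have ht : Tendsto (fun ε : ℝ => -Real.log (1 - ε)) (𝓝 0) (𝓝 (-Real.log (1 - 0))) :=
      ((tendsto_const_nhds.sub tendsto_id).log (by norm_num)).neg
    rw [sub_zero, Real.log_one, neg_zero] at ht
    exact (ht.mono_left nhdsWithin_le_nhds).eventually (gt_mem_nhds hη)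
  filter_upwards [Ioo_mem_nhdsGT_zero, hlog] with ε hε h1
  have hT := T ε hε
  have hlo := hT.lo_pos hε
  refine (iInf₂_le P₁ (hH ε hε)).trans ?_
  rw [h.growthRateAt_robust hfin hε hlo hT.hi_nonneg, EReal.coe_le_coe_iff,
    h.integral_log_robustBet hfin hε hlo hT.hi_nonneg]
  have hs : 0 < supTruncated S L (lo ε) (hi ε) :=
    hlo.trans_le (h.lo_le_supTruncated hfin hT.hi_nonneg)
  have hε1 : 0 < 1 - ε := sub_pos.2 hε.2
  have hden := Real.log_le_log (mul_pos hε1 hs) (h.mul_supTruncated_le hfin hε.1.le hT.hi_nonneg)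
  rw [Real.log_mul hε1.ne' hs.ne'] at hden
  have := h.integral_log_truncatedRatio_le hfin hlo hT.hi_nonneg
  linarith

theorem tendsto_growthRate (h : IsNumeraireRatio S P₁ P₀ L)
    (hconvex : IsConvexFamily S) (hfin : minDiv S P₁ < ∞)
    (T : ∀ ε ∈ Ioo (0 : ℝ) 1, IsHuberThresholds P₀ P₁ L ε (lo ε) (hi ε))
    {H : ℝ → Set (ProbabilityMeasure ℝ)} (hmem : ∀ ε ∈ Ioo (0 : ℝ) 1, P₁ ∈ H ε)
    (hsub : ∀ ε ∈ Ioo (0 : ℝ) 1, H ε ⊆ tvNbhd P₁ ε) :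
    Tendsto (fun ε => growthRate (H ε) (robustProcess S L ε (lo ε) (hi ε))) (𝓝[>] 0)
      (𝓝 (minDiv S P₁ : EReal)) := by
  rw [← coe_minDiv hfin]
  refine tendsto_order.2 ⟨fun a ha => ?_, fun a ha => ?_⟩
  · obtain ⟨z, hz1, hz2⟩ := EReal.lt_iff_exists_real_btwn.1 ha
    filter_upwards [h.eventually_le_growthRate hconvex hfin T hsub
      (sub_pos.2 (EReal.coe_lt_coe_iff.1 hz2))] with ε hε
    rw [sub_sub_cancel] at hε
    exact hz1.trans_le hε
  · obtain ⟨z, hz1, hz2⟩ := EReal.lt_iff_exists_real_btwn.1 ha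
    filter_upwards [h.eventually_growthRate_le hfin T hmem
      (sub_pos.2 (EReal.coe_lt_coe_iff.1 hz1))] with ε hε
    rw [add_sub_cancel] at hε
    exact hε.trans_lt hz2

end IsNumeraireRatio

end RobustRIPr

end

theorem mainTheorem9
    (S : Set (ProbabilityMeasure ℝ)) (P₁ : ProbabilityMeasure ℝ)
    (hclosed : RobustRIPr.IsTVClosed S) (hconvex : RobustRIPr.IsConvexFamily S)
    (hfin : (⨅ P ∈ S, InformationTheory.klDiv (P₁ : Measure ℝ) (P : Measure ℝ)) < ∞)
    -- the reverse information projection, with densities for a common dominating measure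
    (P₀ : Measure ℝ) (hP₀ : RobustRIPr.IsRIPr S P₁ P₀)
    (μ : Measure ℝ) [SigmaFinite μ] (p₀ p₁ : ℝ → ℝ≥0∞)
    (hp₀ : Measurable p₀) (hp₁ : Measurable p₁)
    (hd₀ : P₀ = μ.withDensity p₀) (hd₁ : (P₁ : Measure ℝ) = μ.withDensity p₁)
    -- the likelihood ratio `p₁ / p₀` is not `0 / 0`, almost surely under every member of the null
    (hdef : ∀ P ∈ S, (P : Measure ℝ) ≪ P₀ + (P₁ : Measure ℝ))
    -- the truncation levels
    (lo hi : ℝ → ℝ)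
    (hlohi : ∀ ε ∈ Ioo (0 : ℝ) 1, RobustRIPr.IsHuberThresholds P₀ P₁
      (RobustRIPr.likelihoodRatio p₀ p₁) ε (lo ε) (hi ε))
    -- either model of the contaminated alternative
    (H₁ : ℝ → Set (ProbabilityMeasure ℝ))
    (hH₁ : H₁ = RobustRIPr.contaminationNbhd P₁ ∨ H₁ = RobustRIPr.tvNbhd P₁)
    -- the robust test process
    (R : ℝ → ℕ → (ℕ → ℝ) → ℝ)
    (hR : ∀ ε, R ε =
      RobustRIPr.robustProcess S (RobustRIPr.likelihoodRatio p₀ p₁) ε (lo ε) (hi ε)) :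
    -- the growth rate under each alternative is a genuine limit, almost surely and in mean
    (∀ ε ∈ Ioo (0 : ℝ) 1, ∀ Q ∈ H₁ ε, ∃ r : ℝ,
      RobustRIPr.growthRateAt Q (R ε) = (r : EReal) ∧
      Tendsto (fun n : ℕ => RobustRIPr.meanLog (RobustRIPr.iidLaw Q) (R ε n) / (n : EReal))
        atTop (𝓝 (r : EReal)) ∧
      ∀ᵐ x ∂(RobustRIPr.iidLaw Q),
        Tendsto (fun n : ℕ => Real.log (R ε n x) / (n : ℝ)) atTop (𝓝 r)) ∧
    -- the growth rate converges to the minimal divergence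
    Tendsto (fun ε : ℝ => RobustRIPr.growthRate (H₁ ε) (R ε)) (𝓝[>] 0)
      (𝓝 ((⨅ P ∈ S, InformationTheory.klDiv (P₁ : Measure ℝ) (P : Measure ℝ) : ℝ≥0∞) : EReal)) ∧
    -- which is the optimal growth rate for testing `S` against `P₁`
    IsGreatest {g : EReal | ∃ M : ℕ → (ℕ → ℝ) → ℝ, RobustRIPr.IsTestSupermartingale S M ∧
        g = RobustRIPr.growthRate {P₁} M}
      ((⨅ P ∈ S, InformationTheory.klDiv (P₁ : Measure ℝ) (P : Measure ℝ) : ℝ≥0∞) : EReal) := by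
  have hL : RobustRIPr.IsNumeraireRatio S P₁ P₀ (RobustRIPr.likelihoodRatio p₀ p₁) :=
    hP₀.isNumeraireRatio hfin hp₀ hp₁ hd₀ hd₁ hdef
  obtain rfl : R = fun ε => RobustRIPr.robustProcess S (RobustRIPr.likelihoodRatio p₀ p₁) ε
    (lo ε) (hi ε) := funext hR
  have hmem : ∀ ε ∈ Ioo (0 : ℝ) 1, P₁ ∈ H₁ ε := by
    intro ε hε
    rcases hH₁ with rfl | rfl
    · exact RobustRIPr.self_mem_contaminationNbhd P₁ hε
    · exact RobustRIPr.self_mem_tvNbhd P₁ hε.1.le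
  have hsub : ∀ ε ∈ Ioo (0 : ℝ) 1, H₁ ε ⊆ RobustRIPr.tvNbhd P₁ ε := by
    intro ε hε
    rcases hH₁ with rfl | rfl
    · exact RobustRIPr.contaminationNbhd_subset_tvNbhd P₁ hε
    · exact subset_rfl
  refine ⟨fun ε hε Q _ => ?_, hL.tendsto_growthRate hconvex hfin hlohi hmem hsub,
    hL.isGreatest_growthRate hconvex hfin⟩
  have hlo := (hlohi ε hε).lo_pos hε
  have hhi := (hlohi ε hε).hi_nonneg
  have hm := hL.measurable_robustBet (ε := ε) (lo := lo ε) (hi := hi ε)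
  have hpos := ae_of_all (Q : Measure ℝ) (hL.robustBet_pos hfin hε hlo hhi)
  have hint := hL.integrable_log_robustBet hfin hε hlo hhi Q
  exact ⟨_, RobustRIPr.growthRateAt_prod_eval hm hpos hint,
    RobustRIPr.tendsto_meanLog_prod_eval hm hpos hint,
    RobustRIPr.tendsto_log_prod_eval hm hpos hint⟩
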